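/- All graphs are finite. For a directed acyclic graph (DAG) $G=(V,E)$ and $S\subseteq V$, a node $v\in V\setminus S$ has depth at least $t$ in $G-S$ if $G-S$ contains a directed path with at least $t$ edges ending at $v$. For $V_C\subseteq V$, $s\in\mathbb{N}$ and $t,\alpha\in\mathbb{R}$, the pair $(G,V_C)$ is called $(s,t,\alpha)$-hard if for every $S\subseteq V$ with $|S|\le s$, at least $(1-\alpha)|V_C|$ of the nodes of $V_C$ lie outside $S$ and have depth at least $t$ in $G-S$. (1) For every $\epsilon>0$ there are constants $K,\delta\in\mathbb{N}$, depending only on $\epsilon$, such that for every integer $N\ge 1$ there are a DAG $G$ with at most $K N$ nodes, in which every node has indegree at most $\delta$, and a target set $V_C\subseteq V(G)$ with $|V_C|=N$, such that for every integer $0\le s\le N$ the pair $(G,V_C)$ is $(s,\,N^{1-\epsilon},\,s/N)$-hard. (2) The last parameter is optimal: if $G$ is any DAG, $V_C\subseteq V(G)$ is nonempty, $0\le s\le |V_C|$ is an integer, $t$ and $\alpha$ are real, and $(G,V_C)$ is $(s,t,\alpha)$-hard, then $\alpha\ge s/|V_C|$. -/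

import Mathlib

namespace Digraph

variable {V : Type*}

/-- A digraph is acyclic (a DAG) if no vertex reaches itself by one or more edges. -/
def IsAcyclic (G : Digraph V) : Prop :=
  ∀ v : V, ¬ Relation.TransGen G.Adj v v

/-- The number of edges that enter `v`. -/
noncomputable def indegree (G : Digraph V) (v : V) : ℕ :=
  {u : V | G.Adj u v}.ncard

/-- `v` has depth at least `t` in `G - S`: some directed path of `G` that avoids `S` ends at `v` and
has length (number of edges) at least `t`. The path may consist of `v` alone, so a vertex of `S` has
no depth. All digraphs below are acyclic, so that a directed walk never repeats a vertex. -/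
def HasDepthAtLeast (G : Digraph V) (S : Finset V) (t : ℝ) (v : V) : Prop :=
  ∃ p : RelSeries {e : V × V | G.Adj e.1 e.2},
    p.last = v ∧ (∀ i, p i ∉ S) ∧ t ≤ (p.length : ℝ)

open scoped Classical in
/-- `(G, C)` is `(s, t, α)`-hard: for every set `S` of at most `s` vertices, at least a `1 - α`
fraction of the vertices of `C` have depth at least `t` in `G - S`. -/
def IsHard (G : Digraph V) (C : Finset V) (s : ℕ) (t α : ℝ) : Prop :=
  ∀ S : Finset V, S.card ≤ s →
    (1 - α) * (C.card : ℝ) ≤ ((C.filter fun v => G.HasDepthAtLeast S t v).card : ℝ)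

end Digraph

open Finset

/-! The graph is a depth-robust DAG of size Θ(N) whose vertices feed a linear-size connector with N
outputs, the targets. The DAG keeps long paths when a constant fraction ρ of its vertices is
deleted. As it has at least 2N/ρ vertices, deleting at most N of them leaves a fraction ρ/2 at depth
N^(1-ε). The connector passes this depth on, and each deleted vertex spoils at most one output
(`RankedDag.isHard_feed`); this gives exactly α = s/N. Deleting s targets shows that α cannot be
smaller.

Robustness is phrased through labellings that increase along the surviving edges, and depth is
amplified by `RankedDag.isRobust_chain`: take a copy of G for every k-bit string, put each copy
between two dispersers, and join exits of copies to entries of lexicographically later ones. Suppose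
few vertices are deleted and all labels stay below t * L. Divide labels by t and round down.
Vertices of a copy with the same quotient have labels in one window of length t, so by robustness of
G they are not almost all of the copy. Hence most copies have a value q < L that is at least most
entry quotients and less than most exit quotients. The edges between copies make q almost increasing
in lexicographic order. Such a q is almost invertible: knowing the value, one guesses the string bit
by bit with few errors, so q takes nearly 2^k values (`pow_le_card_values_of_inversions_le`), too
many for L.

For k = a * m a step multiplies the size by 3 * 2^(am) and the depth by 2^((a-1)m). Starting from a
matching, a steps suffice when a is large compared with 1/ε. The number of steps does not grow with
N, so indegree and ρ stay constant.

Connectors (`exists_connector`) come from halving recursion: direct edges serve all but a few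
outputs, and Hall's theorem matches the others to outputs of the inner connector. -/

/-! ### Random bipartite graphs: dispersers and Hall expanders. -/

/-- Union bound for a random `d`-in-regular bipartite graph: if the expected number of pairs
`(E, X)` of the family for which all neighbours of `E` lie in `X` is below one, then some graph has
no such pair. -/
theorem exists_nbr_not_subset {A B ι : Type*} [Fintype A] [Fintype B] [DecidableEq A]
    [DecidableEq B] [Nonempty A] (d : ℕ) (P : Finset ι) (E : ι → Finset B) (X : ι → Finset A)
    (h : ∑ p ∈ P, ((#(X p) : ℝ) / Fintype.card A) ^ (d * #(E p)) < 1) :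
    ∃ nbr : B → Fin d → A, ∀ p ∈ P, ∃ b ∈ E p, ∃ j, nbr b j ∉ X p := by
  classical
  by_contra! hcon
  let bad : ι → Finset (B → Fin d → A) := fun p =>
    Fintype.piFinset fun b => Fintype.piFinset fun _ => if b ∈ E p then X p else univ
  have hcover : (univ : Finset (B → Fin d → A)) ⊆ P.biUnion bad := by
    intro nbr _
    obtain ⟨p, hp, hb⟩ := hcon nbr
    refine mem_biUnion.2 ⟨p, hp, ?_⟩
    simp only [bad, Fintype.mem_piFinset]
    intro b j
    split_ifs with hbE
    · exact hb b hbE j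
    · exact mem_univ _
  have hA : (0 : ℝ) < Fintype.card A := by exact_mod_cast Fintype.card_pos
  have hcard : ∀ p, (#(bad p) : ℝ) = ((#(X p) : ℝ) / Fintype.card A) ^ (d * #(E p)) *
      (Fintype.card A : ℝ) ^ (d * Fintype.card B) := by
    intro p
    have h1 : #(bad p) = ∏ b : B, (if b ∈ E p then #(X p) else Fintype.card A) ^ d := by
      simp only [bad, Fintype.card_piFinset]
      refine prod_congr rfl fun b _ => ?_
      rw [prod_const]
      split_ifs <;> simp
    have h2 : ∀ b : B, (((if b ∈ E p then #(X p) else Fintype.card A) ^ d : ℕ) : ℝ) =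
        (if b ∈ E p then ((#(X p) : ℝ) / Fintype.card A) ^ d else 1) *
          (Fintype.card A : ℝ) ^ d := by
      intro b
      split_ifs
      · push_cast
        rw [div_pow, div_mul_cancel₀]
        positivity
      · simp
    rw [h1, Nat.cast_prod, prod_congr rfl fun b _ => h2 b, prod_mul_distrib, prod_ite_mem,
      univ_inter, prod_const, prod_const, card_univ, pow_mul, pow_mul]
  have h3 := (card_le_card hcover).trans card_biUnion_le
  have h4 : (Fintype.card A : ℝ) ^ (d * Fintype.card B) ≤ ∑ p ∈ P, (#(bad p) : ℝ) := by
    have h5 : #(univ : Finset (B → Fin d → A)) = Fintype.card A ^ (d * Fintype.card B) := by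
      rw [card_univ, Fintype.card_fun, Fintype.card_fun, Fintype.card_fin, pow_mul]
    rw [h5] at h3
    exact_mod_cast h3
  rw [sum_congr rfl fun p _ => hcard p, ← sum_mul] at h4
  have h6 : (0 : ℝ) < (Fintype.card A : ℝ) ^ (d * Fintype.card B) := by positivity
  nlinarith

/-- Constant-degree dispersers exist. -/
theorem exists_disperser {θ : ℝ} (h0 : 0 < θ) (h1 : θ ≤ 1) (c : ℕ) :
    ∃ d : ℕ, ∀ (A B : Type) [Fintype A] [Fintype B] [Nonempty A],
      Fintype.card A ≤ c * Fintype.card B →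
      ∃ nbr : B → Fin d → A, ∀ (X : Finset A) (Y : Finset B),
        θ * Fintype.card A ≤ #X → θ * Fintype.card B ≤ #Y → ∃ b ∈ Y, ∃ j, nbr b j ∈ X := by
  classical
  -- `m` makes `m * #Y` at least |B|, and `e` makes each term at most 2^(-(c+2)|B|), against at most
  -- 2^((c+1)|B|) pairs.
  obtain ⟨m, hm⟩ := exists_nat_ge (1 / θ)
  obtain ⟨e, he⟩ := exists_pow_lt_of_lt_one (show (0 : ℝ) < (1 / 2) ^ (c + 2) by positivity)
    (show 1 - θ < 1 by linarith)
  refine ⟨e * m, fun A B _ _ _ hAB => ?_⟩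
  have hA : 0 < Fintype.card A := Fintype.card_pos
  have hB : 0 < Fintype.card B := by
    rcases Nat.eq_zero_or_pos (Fintype.card B) with h | h
    · rw [h] at hAB; omega
    · exact h
  have hA' : (0 : ℝ) < Fintype.card A := by exact_mod_cast hA
  have hB' : (0 : ℝ) < Fintype.card B := by exact_mod_cast hB
  let P : Finset (Finset A × Finset B) :=
    univ.filter fun p => θ * Fintype.card A ≤ #p.1 ∧ θ * Fintype.card B ≤ #p.2
  obtain ⟨nbr, hn⟩ := exists_nbr_not_subset (e * m) P (fun p => p.2) (fun p => p.1ᶜ) (by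
    have hterm : ∀ p ∈ P, ((#(p.1ᶜ) : ℝ) / Fintype.card A) ^ (e * m * #p.2) ≤
        (1 / 2) ^ ((c + 2) * Fintype.card B) := by
      intro p hp
      obtain ⟨hp1, hp2⟩ := (mem_filter.1 hp).2
      have h2 : (#(p.1ᶜ) : ℝ) / Fintype.card A ≤ 1 - θ := by
        rw [div_le_iff₀ hA', card_compl, Nat.cast_sub (card_le_univ _)]
        linarith
      have h3 : Fintype.card B ≤ m * #p.2 := by
        have : (Fintype.card B : ℝ) ≤ m * #p.2 := by
          have h4 : 1 ≤ θ * m := by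
            rw [div_le_iff₀ h0] at hm; linarith
          have h5 : (0 : ℝ) ≤ m := Nat.cast_nonneg _
          nlinarith
        exact_mod_cast this
      calc ((#(p.1ᶜ) : ℝ) / Fintype.card A) ^ (e * m * #p.2)
          ≤ (1 - θ) ^ (e * m * #p.2) := pow_le_pow_left₀ (by positivity) h2 _
        _ = ((1 - θ) ^ e) ^ (m * #p.2) := by rw [← pow_mul, mul_assoc]
        _ ≤ ((1 - θ) ^ e) ^ (Fintype.card B) := by
            apply pow_le_pow_of_le_one _ _ h3
            · exact pow_nonneg (by linarith) _
            · exact pow_le_one₀ (by linarith) (by linarith)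
        _ ≤ ((1 / 2) ^ (c + 2)) ^ (Fintype.card B) :=
            pow_le_pow_left₀ (pow_nonneg (by linarith) _) he.le _
        _ = _ := by rw [← pow_mul]
    have hPcard : (#P : ℝ) ≤ 2 ^ ((c + 1) * Fintype.card B) := by
      have : #P ≤ 2 ^ ((c + 1) * Fintype.card B) := by
        calc #P ≤ Fintype.card (Finset A × Finset B) := card_le_univ _
          _ = 2 ^ (Fintype.card A + Fintype.card B) := by
            rw [Fintype.card_prod, Fintype.card_finset, Fintype.card_finset, pow_add]
          _ ≤ _ := Nat.pow_le_pow_right (by norm_num) (by linarith)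
      exact_mod_cast this
    calc _ ≤ ∑ p ∈ P, ((1 : ℝ) / 2) ^ ((c + 2) * Fintype.card B) := sum_le_sum hterm
      _ = #P * ((1 : ℝ) / 2) ^ ((c + 2) * Fintype.card B) := by rw [sum_const, nsmul_eq_mul]
      _ ≤ 2 ^ ((c + 1) * Fintype.card B) * ((1 : ℝ) / 2) ^ ((c + 2) * Fintype.card B) := by gcongr
      _ = (1 / 2) ^ Fintype.card B := by
          rw [show (c + 2) * Fintype.card B = (c + 1) * Fintype.card B + Fintype.card B by ring,
            pow_add, ← mul_assoc, ← mul_pow]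
          norm_num
      _ < 1 := pow_lt_one₀ (by norm_num) (by norm_num) hB.ne')
  refine ⟨nbr, fun X Y hX hY => ?_⟩
  obtain ⟨b, hb, j, hj⟩ := hn (X, Y) (mem_filter.2 ⟨mem_univ _, hX, hY⟩)
  exact ⟨b, hb, j, by simpa using hj⟩

theorem choose_le_mul_div_pow (n k : ℕ) (hk : 1 ≤ k) :
    (n.choose k : ℝ) ≤ (Real.exp 1 * n / k) ^ k := by
  have hk' : (0 : ℝ) < k := by exact_mod_cast hk
  have h1 := Nat.choose_le_pow_div (α := ℝ) k n
  have h2 := Real.pow_div_factorial_le_exp (k : ℝ) hk'.le k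
  have hf : (0 : ℝ) < k.factorial := by exact_mod_cast Nat.factorial_pos k
  refine h1.trans ?_
  rw [div_pow, mul_pow, ← Real.exp_nat_mul, mul_one, div_le_div_iff₀ hf (by positivity)]
  rw [div_le_iff₀ hf] at h2
  calc (n : ℝ) ^ k * (k : ℝ) ^ k ≤ (n : ℝ) ^ k * (Real.exp k * k.factorial) := by gcongr
    _ = _ := by ring

/-- Constant-degree bipartite graphs in which small sets satisfy Hall's condition exist. -/
theorem exists_expander :
    ∃ d : ℕ, ∀ (A B : Type) [Fintype A] [Fintype B] [Nonempty A] [DecidableEq A],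
      Fintype.card B ≤ 3 * Fintype.card A →
      ∃ nbr : B → Fin d → A, ∀ E : Finset B, 16 * #E ≤ 3 * Fintype.card A →
        #E ≤ #(E.biUnion fun b => univ.image (nbr b)) := by
  classical
  refine ⟨6, fun A B _ _ _ _ hAB => ?_⟩
  have hA : 0 < Fintype.card A := Fintype.card_pos
  have hA' : (0 : ℝ) < Fintype.card A := by exact_mod_cast hA
  set α := Fintype.card A with hα
  set β := Fintype.card B with hβ
  -- The neighbourhood of a Hall violator `E` can be padded to size `#E`, so pairs of equal size
  -- suffice.
  let P : Finset (Σ _ : ℕ, Finset B × Finset A) :=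
    ((Icc 1 α).filter fun k => 16 * k ≤ 3 * α).sigma fun k =>
      powersetCard k univ ×ˢ powersetCard k univ
  obtain ⟨nbr, hn⟩ := exists_nbr_not_subset 6 P (fun p => p.2.1) (fun p => p.2.2) (by
    rw [sum_sigma]
    have hinner : ∀ k ∈ (Icc 1 α).filter (fun k => 16 * k ≤ 3 * α),
        ∑ s ∈ powersetCard k (univ : Finset B) ×ˢ powersetCard k (univ : Finset A),
          ((#s.2 : ℝ) / Fintype.card A) ^ (6 * #s.1) ≤ (1 / 4) ^ k := by
      intro k hk
      obtain ⟨hk1, hk2⟩ := mem_filter.1 hk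
      have hk1 := (mem_Icc.1 hk1).1
      have hk' : (0 : ℝ) < k := by exact_mod_cast hk1
      have hkA : (k : ℝ) / α ≤ 3 / 16 := by
        rw [div_le_div_iff₀ hA' (by norm_num)]
        have : (16 * k : ℝ) ≤ 3 * α := by exact_mod_cast hk2
        linarith
      have hconst : ∀ s ∈ powersetCard k (univ : Finset B) ×ˢ powersetCard k (univ : Finset A),
          ((#s.2 : ℝ) / Fintype.card A) ^ (6 * #s.1) = (((k : ℝ) / α) ^ 6) ^ k := by
        intro s hs
        obtain ⟨hs1, hs2⟩ := mem_product.1 hs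
        rw [(mem_powersetCard.1 hs1).2, (mem_powersetCard.1 hs2).2, pow_mul]
      rw [sum_congr rfl hconst, sum_const, card_product, card_powersetCard, card_powersetCard,
        card_univ, card_univ, nsmul_eq_mul, Nat.cast_mul]
      have hb := choose_le_mul_div_pow β k hk1
      have ha := choose_le_mul_div_pow α k hk1
      have hβα : (β : ℝ) ≤ 3 * α := by exact_mod_cast hAB
      have he : Real.exp 1 ≤ 3 := by linarith [Real.exp_one_lt_d9]
      have he0 := Real.exp_pos 1
      calc (β.choose k : ℝ) * (α.choose k) * (((k : ℝ) / α) ^ 6) ^ k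
          ≤ (Real.exp 1 * β / k) ^ k * (Real.exp 1 * α / k) ^ k * (((k : ℝ) / α) ^ 6) ^ k := by
            gcongr
        _ = ((Real.exp 1 * β / k) * (Real.exp 1 * α / k) * ((k : ℝ) / α) ^ 6) ^ k := by
            rw [mul_pow, mul_pow]
        _ ≤ (1 / 4) ^ k := by
            -- The two binomials cost 27 (α/k)^2 and the six neighbours gain (k/α)^6; finally k/α ≤
            -- 3/16.
            refine pow_le_pow_left₀ (by positivity) ?_ k
            calc (Real.exp 1 * β / k) * (Real.exp 1 * α / k) * ((k : ℝ) / α) ^ 6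
                ≤ (3 * (3 * α) / k) * (3 * α / k) * ((k : ℝ) / α) ^ 6 := by gcongr
              _ = 27 * ((k : ℝ) / α) ^ 4 := by field_simp; ring
              _ ≤ 27 * (3 / 16) ^ 4 := by gcongr
              _ ≤ 1 / 4 := by norm_num
    refine (sum_le_sum hinner).trans_lt ?_
    refine (sum_le_sum_of_subset_of_nonneg (filter_subset _ _) fun _ _ _ => by positivity).trans_lt
      (?_ : ∑ k ∈ Icc 1 α, ((1 : ℝ) / 4) ^ k < 1)
    have hgeom : ∀ n : ℕ, ∑ k ∈ Icc 1 n, ((1 : ℝ) / 4) ^ k ≤ 1 / 3 - 1 / 3 * (1 / 4) ^ n := by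
      intro n
      induction n with
      | zero => simp
      | succ n ih =>
        rw [sum_Icc_succ_top (by omega)]
        rw [pow_succ]
        linarith
    have := hgeom α
    have h4 : (0 : ℝ) < (1 / 4) ^ α := by positivity
    linarith)
  refine ⟨nbr, fun E hE => ?_⟩
  by_contra! hlt
  have hEα : #E ≤ α := by omega
  obtain ⟨X, hX1, hX2⟩ := exists_superset_card_eq hlt.le hEα
  obtain ⟨b, hb, j, hj⟩ := hn ⟨#E, E, X⟩ (by
    simp only [P, mem_sigma, mem_filter, mem_Icc, mem_product, mem_powersetCard]
    refine ⟨⟨⟨by omega, hEα⟩, hE⟩, ⟨subset_univ _, trivial⟩, subset_univ _, hX2⟩)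
  exact hj (hX1 (mem_biUnion.2 ⟨b, hb, mem_image_of_mem _ (mem_univ j)⟩))

/-! ### Functions on bit strings with few inversions. -/

theorem sum_comp_eq_sum_range {I : Type*} [Fintype I] (q : I → ℕ) {L : ℕ} (hq : ∀ i, q i < L)
    (F : ℕ → ℕ) : ∑ i, F (q i) = ∑ v ∈ range L, #{i | q i = v} * F v := by
  rw [← sum_fiberwise_of_maps_to (t := range L) (g := q) fun i _ => mem_range.2 (hq i)]
  refine sum_congr rfl fun v _ => ?_
  rw [sum_congr rfl (g := fun _ => F v), sum_const, smul_eq_mul]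
  intro i hi
  rw [(mem_filter.1 hi).2]

/-- If two families of values overlap much, then there are many inverted pairs between them. -/
theorem sq_sum_min_le_inverted {I J : Type*} [Fintype I] [Fintype J] (p : I → ℕ) (q : J → ℕ) {L : ℕ}
    (hp : ∀ i, p i < L) (hq : ∀ j, q j < L) :
    (∑ v ∈ range L, min #{i | p i = v} #{j | q j = v}) ^ 2 ≤
      2 * ∑ i, ∑ j, if q j ≤ p i then 1 else 0 := by
  have h1 : ∑ i, ∑ j, (if q j ≤ p i then 1 else 0) =
      ∑ v ∈ range L, ∑ w ∈ range L, if w ≤ v then #{i | p i = v} * #{j | q j = w} else 0 := by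
    rw [sum_comp_eq_sum_range p hp fun v => ∑ j, if q j ≤ v then 1 else 0]
    refine sum_congr rfl fun v _ => ?_
    rw [sum_comp_eq_sum_range q hq fun w => if w ≤ v then 1 else 0, mul_sum]
    refine sum_congr rfl fun w _ => ?_
    split_ifs <;> simp
  set m : ℕ → ℕ := fun v => min #{i | p i = v} #{j | q j = v} with hm
  -- For any two values `v`, `w` at least one of the two orders counts as inverted, whence the
  -- factor 2.
  have h2 : (∑ v ∈ range L, m v) ^ 2 ≤
      2 * ∑ v ∈ range L, ∑ w ∈ range L, if w ≤ v then m v * m w else 0 := by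
    have h3 : ∑ v ∈ range L, ∑ w ∈ range L, (if w ≤ v then m v * m w else 0) =
        ∑ v ∈ range L, ∑ w ∈ range L, (if v ≤ w then m v * m w else 0) := by
      rw [sum_comm]
      refine sum_congr rfl fun v _ => sum_congr rfl fun w _ => ?_
      rw [mul_comm]
    rw [two_mul]
    nth_rw 2 [h3]
    rw [← sum_add_distrib, sq, sum_mul_sum]
    refine sum_le_sum fun v _ => ?_
    rw [← sum_add_distrib]
    refine sum_le_sum fun w _ => ?_
    rcases le_total v w with h | h <;> simp [h]
  rw [h1]
  refine h2.trans (Nat.mul_le_mul_left _ (sum_le_sum fun v _ => sum_le_sum fun w _ => ?_))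
  split_ifs
  · exact Nat.mul_le_mul (min_le_left _ _) (min_le_right _ _)
  · exact le_rfl

/-- Flip bit `h` of the first string and exchange the tails of the two strings behind `h`. -/
def tailSwap {k : ℕ} (h : Fin k) (p : (Fin k → Bool) × (Fin k → Bool)) :
    (Fin k → Bool) × (Fin k → Bool) :=
  (fun j => if j < h then p.1 j else if j = h then !p.1 j else p.2 j,
   fun j => if j ≤ h then p.2 j else p.1 j)

theorem tailSwap_involutive {k : ℕ} (h : Fin k) : Function.Involutive (tailSwap h) := by
  rintro ⟨i, z⟩
  refine Prod.ext (funext fun j => ?_) (funext fun j => ?_)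
  · rcases lt_trichotomy j h with hj | hj | hj
    · simp [tailSwap, hj]
    · simp [tailSwap, hj]
    · simp [tailSwap, hj.not_gt, hj.ne', hj.not_ge]
  · rcases le_or_gt j h with hj | hj
    · simp [tailSwap, hj]
    · simp [tailSwap, hj.not_ge, hj.not_gt, hj.ne']

/-- The number of pairs of strings, weighted by the number of positions and tails that link them,
which a function on bit strings fails to put in lexicographic order. -/
def inversions {k : ℕ} (q : (Fin k → Bool) → ℕ) : ℕ :=
  ∑ h : Fin k, ∑ i : Fin k → Bool, ∑ z : Fin k → Bool,
    if i h = false ∧ q (tailSwap h (i, z)).1 ≤ q i then 1 else 0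

theorem sum_bitstring_succ {M : Type*} [AddCommMonoid M] {k : ℕ} (g : (Fin (k + 1) → Bool) → M) :
    ∑ i, g i = ∑ i : Fin k → Bool, g (Fin.cons false i) + ∑ i : Fin k → Bool, g (Fin.cons true i) := by
  rw [← (Fin.consEquiv fun _ : Fin (k + 1) => Bool).sum_comp, Fintype.sum_prod_type,
    Fintype.sum_bool, add_comm]
  rfl

theorem tailSwap_zero_fst {k : ℕ} (a b : Bool) (i z : Fin k → Bool) :
    (tailSwap 0 ((Fin.cons a i, Fin.cons b z) : (Fin (k + 1) → Bool) × (Fin (k + 1) → Bool))).1 =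
      Fin.cons (!a) z := by
  funext j
  refine Fin.cases ?_ (fun j => ?_) j
  · simp [tailSwap]
  · simp [tailSwap, Fin.succ_ne_zero]

theorem tailSwap_succ_fst {k : ℕ} (h : Fin k) (a b : Bool) (i z : Fin k → Bool) :
    (tailSwap h.succ
      ((Fin.cons a i, Fin.cons b z) : (Fin (k + 1) → Bool) × (Fin (k + 1) → Bool))).1 =
      Fin.cons a (tailSwap h (i, z)).1 := by
  funext j
  refine Fin.cases ?_ (fun j => ?_) j
  · simp [tailSwap]
  · simp [tailSwap]

/-- Position 0 compares the two halves of the cube, later positions stay inside a half. Both factors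
2 come from the first bit of `z`, which `tailSwap` never copies into the first string. -/
theorem inversions_succ {k : ℕ} (q : (Fin (k + 1) → Bool) → ℕ) :
    inversions q =
      2 * (∑ i : Fin k → Bool, ∑ j : Fin k → Bool,
        if q (Fin.cons true j) ≤ q (Fin.cons false i) then 1 else 0) +
      2 * (inversions (fun i : Fin k → Bool => q (Fin.cons false i)) +
        inversions (fun i : Fin k → Bool => q (Fin.cons true i))) := by
  unfold inversions
  rw [Fin.sum_univ_succ]
  congr 1
  · rw [sum_bitstring_succ]
    simp only [sum_bitstring_succ (k := k), tailSwap_zero_fst, Fin.cons_zero, true_and,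
      Bool.not_false, Bool.true_eq_false, false_and, if_false, sum_const_zero, add_zero]
    rw [two_mul, ← sum_add_distrib]
  · rw [← sum_add_distrib, mul_sum]
    refine sum_congr rfl fun h _ => ?_
    simp only [sum_bitstring_succ (k := k), tailSwap_succ_fst, Fin.cons_succ]
    simp only [sum_add_distrib]
    ring

/-- A function on bit strings with few inversions lets one recover a string from its value and few
corrections: the `e i` count the corrections needed for `i`. -/
theorem exists_correction_count {x η : ℝ} (hx : 0 < x) (hη : 0 < η) (L : ℕ) :
    ∀ (k : ℕ) (q : (Fin k → Bool) → ℕ), (∀ i, q i < L) →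
      ∃ e : (Fin k → Bool) → ℕ,
        (∀ v, ∑ i, (if q i = v then x ^ e i else 0) ≤ (1 + x) ^ k) ∧
        ∑ i, (e i : ℝ) ≤ 2 ^ k * k * η + inversions q / (4 * η * 2 ^ k) := by
  intro k
  induction k with
  | zero =>
    intro q hq
    refine ⟨fun _ => 0, fun v => ?_, by simp [inversions]⟩
    rw [Fintype.sum_unique]
    split_ifs <;> simp
  | succ k ih =>
    intro q hq
    set q0 : (Fin k → Bool) → ℕ := fun i => q (Fin.cons false i) with hq0
    set q1 : (Fin k → Bool) → ℕ := fun i => q (Fin.cons true i) with hq1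
    obtain ⟨e0, he0, hs0⟩ := ih q0 fun i => hq _
    obtain ⟨e1, he1, hs1⟩ := ih q1 fun i => hq _
    -- Given the value `v`, the first bit is guessed to be the one with more preimages of `v`
    -- (`false` on ties). `l0 v` and `l1 v` are the corrections for a true bit `false` and `true`:
    -- one is 0 and the other 1, which produces the factor 1 + x.
    let l0 : ℕ → ℕ := fun v => if #{i | q0 i = v} < #{i | q1 i = v} then 1 else 0
    let l1 : ℕ → ℕ := fun v => if #{i | q0 i = v} < #{i | q1 i = v} then 0 else 1
    let e : (Fin (k + 1) → Bool) → ℕ := fun i =>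
      bif i 0 then e1 (Fin.tail i) + l1 (q i) else e0 (Fin.tail i) + l0 (q i)
    have hef : ∀ i, e (Fin.cons false i) = e0 i + l0 (q0 i) := fun i => by simp [e, hq0]
    have het : ∀ i, e (Fin.cons true i) = e1 i + l1 (q1 i) := fun i => by simp [e, hq1]
    refine ⟨e, fun v => ?_, ?_⟩
    · rw [sum_bitstring_succ]
      have h0 : ∀ i : Fin k → Bool, (if q (Fin.cons false i) = v then x ^ e (Fin.cons false i)
          else 0) = (if q0 i = v then x ^ e0 i else 0) * x ^ l0 v := by
        intro i
        rw [hef]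
        by_cases h : q0 i = v
        · rw [if_pos h, if_pos h, h, pow_add]
        · rw [if_neg h, if_neg h, zero_mul]
      have h1 : ∀ i : Fin k → Bool, (if q (Fin.cons true i) = v then x ^ e (Fin.cons true i)
          else 0) = (if q1 i = v then x ^ e1 i else 0) * x ^ l1 v := by
        intro i
        rw [het]
        by_cases h : q1 i = v
        · rw [if_pos h, if_pos h, h, pow_add]
        · rw [if_neg h, if_neg h, zero_mul]
      rw [sum_congr rfl fun i _ => h0 i, sum_congr rfl fun i _ => h1 i, ← sum_mul, ← sum_mul,
        pow_succ]
      have a0 := he0 v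
      have a1 := he1 v
      by_cases h : #{i | q0 i = v} < #{i | q1 i = v}
      · simp only [l0, l1, if_pos h, pow_one, pow_zero]
        nlinarith
      · simp only [l0, l1, if_neg h, pow_one, pow_zero]
        nlinarith
    · have hsum : ∑ i, e i = ∑ i, e0 i + ∑ i, e1 i +
          ∑ v ∈ range L, min #{i | q0 i = v} #{i | q1 i = v} := by
        rw [sum_bitstring_succ, sum_congr rfl fun i _ => hef i, sum_congr rfl fun i _ => het i,
          sum_add_distrib, sum_add_distrib, sum_comp_eq_sum_range q0 (fun i => hq _) l0,
          sum_comp_eq_sum_range q1 (fun i => hq _) l1]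
        have : ∑ v ∈ range L, min #{i | q0 i = v} #{i | q1 i = v} =
            ∑ v ∈ range L, #{i | q0 i = v} * l0 v + ∑ v ∈ range L, #{i | q1 i = v} * l1 v := by
          rw [← sum_add_distrib]
          refine sum_congr rfl fun v _ => ?_
          by_cases h : #{i | q0 i = v} < #{i | q1 i = v}
          · simp only [l0, l1, if_pos h, mul_one, mul_zero, add_zero]
            exact min_eq_left h.le
          · simp only [l0, l1, if_neg h, mul_one, mul_zero, zero_add]
            exact min_eq_right (not_lt.1 h)
        rw [this]
        ring
      have herr := sq_sum_min_le_inverted q0 q1 (L := L) (fun i => hq _) (fun i => hq _)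
      have hinv := inversions_succ q
      set c := ∑ i, ∑ j, if q1 j ≤ q0 i then 1 else 0 with hc
      set r := ∑ v ∈ range L, min #{i | q0 i = v} #{i | q1 i = v} with hr
      have hinv' : (inversions q : ℝ) = 2 * c + 2 * (inversions q0 + inversions q1) := by
        rw [hinv]; push_cast; rfl
      have herr' : (r : ℝ) ^ 2 ≤ 2 * c := by exact_mod_cast herr
      have hsum' : ∑ i, (e i : ℝ) = ∑ i, (e0 i : ℝ) + ∑ i, (e1 i : ℝ) + r := by
        exact_mod_cast hsum
      have hM : (0 : ℝ) < 2 ^ k := by positivity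
      -- The number `r` of wrong first guesses is at most √(2c); AM-GM makes this linear in `c`, so
      -- that the bound adds up along the recursion.
      have hamgm : (r : ℝ) ≤ 2 * 2 ^ k * η + 2 * c / (4 * η * (2 * 2 ^ k)) := by
        have h2 : (r : ℝ) ≤ 2 * 2 ^ k * η + (r : ℝ) ^ 2 / (4 * η * (2 * 2 ^ k)) := by
          have h3 : 2 * 2 ^ k * η + (r : ℝ) ^ 2 / (4 * η * (2 * 2 ^ k)) - r =
              (2 * (2 * 2 ^ k * η) - r) ^ 2 / (4 * η * (2 * 2 ^ k)) := by
            field_simp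
            ring
          have h4 : 0 ≤ (2 * (2 * 2 ^ k * η) - (r : ℝ)) ^ 2 / (4 * η * (2 * 2 ^ k)) := by positivity
          linarith
        refine h2.trans ?_
        gcongr
      rw [hsum', hinv', pow_succ]
      push_cast
      have h5 : (2 * c + 2 * ((inversions q0 : ℝ) + inversions q1)) / (4 * η * (2 ^ k * 2)) =
          2 * c / (4 * η * (2 * 2 ^ k)) + inversions q0 / (4 * η * 2 ^ k) +
            inversions q1 / (4 * η * 2 ^ k) := by
        field_simp
        ring
      rw [h5]
      linarith

/-- A function on bit strings with few inversions takes many values. -/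
theorem pow_le_card_values_of_inversions_le {x η : ℝ} (hx : 0 < x) (hx1 : x ≤ 1) (hη : 0 < η)
    {L k : ℕ} (q : (Fin k → Bool) → ℕ) (hq : ∀ i, q i < L)
    (hinv : (inversions q : ℝ) ≤ 4 * η ^ 2 * k * 4 ^ k) :
    (2 * x ^ (2 * η)) ^ k ≤ L * (1 + x) ^ k := by
  obtain ⟨e, he, hs⟩ := exists_correction_count hx hη L k q hq
  have hM : (0 : ℝ) < 2 ^ k := by positivity
  have hs' : ∑ i, (e i : ℝ) ≤ 2 ^ k * (2 * η * k) := by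
    have h1 : inversions q / (4 * η * 2 ^ k) ≤ 2 ^ k * k * η := by
      rw [div_le_iff₀ (by positivity)]
      refine hinv.trans (le_of_eq ?_)
      rw [show (4 : ℝ) = 2 * 2 by norm_num, mul_pow]
      ring
    linarith
  have hlog : Real.log x ≤ 0 := Real.log_nonpos hx.le hx1
  -- Jensen's inequality for the convex function e ↦ x^e, through its tangent at 2ηk, which bounds
  -- the mean of `e`.
  have htangent : ∀ i, x ^ (2 * η * k) * (1 + (e i - 2 * η * k) * Real.log x) ≤ x ^ e i := by
    intro i
    have h1 : x ^ e i = x ^ (2 * η * k) * x ^ ((e i : ℝ) - 2 * η * k) := by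
      rw [← Real.rpow_add hx, add_sub_cancel, Real.rpow_natCast]
    rw [h1]
    refine mul_le_mul_of_nonneg_left ?_ (Real.rpow_nonneg hx.le _)
    rw [Real.rpow_def_of_pos hx]
    have := Real.add_one_le_exp (Real.log x * ((e i : ℝ) - 2 * η * k))
    linarith
  have hlow : 2 ^ k * x ^ (2 * η * k) ≤ ∑ i, x ^ e i := by
    refine le_trans ?_ (sum_le_sum fun i _ => htangent i)
    rw [← mul_sum, sum_add_distrib, ← sum_mul, sum_sub_distrib]
    simp only [sum_const, card_univ, Fintype.card_fun, Fintype.card_bool, Fintype.card_fin,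
      nsmul_eq_mul, mul_one, Nat.cast_pow, Nat.cast_ofNat]
    have h2 : 0 ≤ (∑ i, (e i : ℝ) - 2 ^ k * (2 * η * k)) * Real.log x :=
      mul_nonneg_of_nonpos_of_nonpos (by linarith) hlog
    have h3 : 0 < x ^ (2 * η * k) := Real.rpow_pos_of_pos hx _
    nlinarith
  have hup : ∑ i, x ^ e i ≤ L * (1 + x) ^ k := by
    calc ∑ i, x ^ e i = ∑ i, ∑ v ∈ range L, if q i = v then x ^ e i else 0 := by
          refine sum_congr rfl fun i _ => ?_
          rw [sum_ite_eq, if_pos (mem_range.2 (hq i))]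
      _ = ∑ v ∈ range L, ∑ i, if q i = v then x ^ e i else 0 := sum_comm
      _ ≤ ∑ v ∈ range L, (1 + x) ^ k := sum_le_sum fun v _ => he v
      _ = _ := by rw [sum_const, card_range, nsmul_eq_mul]
  rw [mul_pow, ← Real.rpow_mul_natCast hx.le]
  exact hlow.trans hup

/-! ### Robust digraphs and separating values. -/

/-- A digraph given by the finite sets of in-neighbours of its vertices, with a rank that increases
along the edges. -/
structure RankedDag (V : Type) where
  par : V → Finset V
  rank : V → ℕ
  rank_lt : ∀ v, ∀ u ∈ par v, rank u < rank v

/-- If at most a fraction `ρ` of the vertices is deleted, then every function that increases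
strictly along the remaining edges attains a value at least `t` on the remaining vertices. -/
def RankedDag.IsRobust {V : Type} [Fintype V] (G : RankedDag V) (ρ : ℝ) (t : ℕ) : Prop :=
  ∀ S : Finset V, (#S : ℝ) ≤ ρ * Fintype.card V → ∀ f : V → ℕ,
    (∀ v, v ∉ S → ∀ u ∈ G.par v, u ∉ S → f u < f v) → ∃ v, v ∉ S ∧ t ≤ f v

/-- In a robust digraph between two dispersers, some value separates most of the entry side from
most of the exit side. -/
theorem exists_separating_value {V I : Type} [Fintype V] [Fintype I] [DecidableEq V]
    [DecidableEq I] [Nonempty V] (G : RankedDag V) {ρ θ : ℝ} {t d L : ℕ} (hθ : 0 < θ)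
    (hθρ : 3 * θ ≤ ρ) (hρ1 : ρ ≤ 1) (ht : 1 ≤ t) (hG : G.IsRobust ρ t)
    (hcard : Fintype.card I = Fintype.card V) (nbr1 : V → Fin d → I) (nbr2 : I → Fin d → V)
    (h1 : ∀ (X : Finset I) (Y : Finset V), θ * Fintype.card I ≤ #X → θ * Fintype.card V ≤ #Y →
      ∃ b ∈ Y, ∃ j, nbr1 b j ∈ X)
    (h2 : ∀ (X : Finset V) (Y : Finset I), θ * Fintype.card V ≤ #X → θ * Fintype.card I ≤ #Y →
      ∃ b ∈ Y, ∃ j, nbr2 b j ∈ X)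
    (SI SO : Finset I) (SV : Finset V) (fI fO : I → ℕ) (fV : V → ℕ)
    (hSV : (#SV : ℝ) ≤ θ * Fintype.card V)
    (hV : ∀ v, v ∉ SV → ∀ u ∈ G.par v, u ∉ SV → fV u < fV v)
    (hIV : ∀ v, v ∉ SV → ∀ j, nbr1 v j ∉ SI → fI (nbr1 v j) < fV v)
    (hVO : ∀ y, y ∉ SO → ∀ j, nbr2 y j ∉ SV → fV (nbr2 y j) < fO y)
    (hL : ∀ v, v ∉ SV → fV v < t * L) :
    ∃ q, q < L ∧
      (#{x | x ∉ SI ∧ q < fI x / t} : ℝ) < θ * Fintype.card V ∧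
      (#{y | y ∉ SO ∧ fO y / t ≤ q} : ℝ) < θ * Fintype.card V := by
  set n : ℝ := (Fintype.card V : ℝ) with hn
  have hn0 : 0 < n := by rw [hn]; exact_mod_cast Fintype.card_pos
  have hsurv : n - θ * n ≤ #SVᶜ := by
    rw [card_compl, Nat.cast_sub (card_le_univ _)]; linarith
  have hLpos : 0 < L := by
    rcases Nat.eq_zero_or_pos L with h | h
    · exfalso
      have h3 : (0 : ℝ) < #SVᶜ := by nlinarith
      obtain ⟨v, hv⟩ := card_pos.1 (by exact_mod_cast h3 : 0 < #SVᶜ)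
      have := hL v (by simpa using hv)
      simp [h] at this
    · exact h
  have hFL : ∀ v, v ∉ SV → fV v / t < L := fun v hv => Nat.div_lt_of_lt_mul (hL v hv)
  have hex : ∃ q, θ * n ≤ #{v | v ∉ SV ∧ fV v / t ≤ q} := by
    refine ⟨L - 1, ?_⟩
    have : SVᶜ ⊆ univ.filter fun v => v ∉ SV ∧ fV v / t ≤ L - 1 := by
      intro v hv
      have hv' : v ∉ SV := by simpa using hv
      have := hFL v hv'
      exact mem_filter.2 ⟨mem_univ _, hv', by omega⟩
    have h3 : (#SVᶜ : ℝ) ≤ #{v | v ∉ SV ∧ fV v / t ≤ L - 1} := by exact_mod_cast card_le_card this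
    nlinarith
  classical
  -- The separating value is the θ-quantile of the labels divided by t: fewer than θn survivors lie
  -- strictly below it.
  obtain ⟨q, hq, hqmin⟩ : ∃ q, θ * n ≤ #{v | v ∉ SV ∧ fV v / t ≤ q} ∧
      ∀ p < q, ¬ θ * n ≤ #{v | v ∉ SV ∧ fV v / t ≤ p} :=
    ⟨Nat.find hex, Nat.find_spec hex, fun p hp => Nat.find_min hex hp⟩
  have hlt : (#{v | v ∉ SV ∧ fV v / t < q} : ℝ) < θ * n := by
    rcases Nat.eq_zero_or_pos q with h | h
    · subst h
      simp only [not_lt_zero, and_false, filter_false, card_empty, Nat.cast_zero]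
      positivity
    · have h3 := not_le.1 (hqmin (q - 1) (by omega))
      have h4 : (univ.filter fun v => v ∉ SV ∧ fV v / t < q) =
          univ.filter fun v => v ∉ SV ∧ fV v / t ≤ q - 1 :=
        filter_congr fun v _ => and_congr_right fun _ => by omega
      rw [h4]
      exact h3
  have hqL : q < L := by
    have h3 : (0 : ℝ) < #{v | v ∉ SV ∧ fV v / t ≤ q} := lt_of_lt_of_le (by positivity) hq
    by_contra! hLq
    rcases Nat.eq_zero_or_pos q with h | h
    · omega
    · refine hqmin (q - 1) (by omega) (hq.trans ?_)
      have : (univ.filter fun v => v ∉ SV ∧ fV v / t ≤ q) ⊆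
          univ.filter fun v => v ∉ SV ∧ fV v / t ≤ q - 1 := by
        intro v hv
        obtain ⟨hv1, hv2⟩ := (mem_filter.1 hv).2
        have := hFL v hv1
        exact mem_filter.2 ⟨mem_univ _, hv1, by omega⟩
      exact_mod_cast card_le_card this
  -- Otherwise keeping only this level set deletes at most ρn vertices, while the labels shifted by
  -- q * t stay below t, against robustness. So at least (ρ - 2θ)n ≥ θn survivors lie above q.
  have heq : (#{v | v ∉ SV ∧ fV v / t = q} : ℝ) < (1 - ρ) * n := by
    by_contra! hcon
    set W : Finset V := {v | v ∉ SV ∧ fV v / t = q} with hW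
    have hmem : ∀ v, v ∉ Wᶜ ↔ v ∉ SV ∧ fV v / t = q := fun v => by simp [hW]
    obtain ⟨v, hv, hvt⟩ := hG Wᶜ (by
      rw [card_compl, Nat.cast_sub (card_le_univ _)]; linarith) (fun v => fV v - q * t) (by
      intro v hv u hu hu'
      rw [hmem] at hv hu'
      have := hV v hv.1 u hu hu'.1
      have h4 : q * t ≤ fV u := by rw [← hu'.2]; exact Nat.div_mul_le_self _ _
      show fV u - q * t < fV v - q * t
      omega)
    rw [hmem] at hv
    have h5 : fV v < (q + 1) * t := by
      rw [← hv.2]; exact Nat.lt_mul_of_div_lt (Nat.lt_succ_self _) ht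
    rw [add_mul] at h5
    omega
  have hhi : θ * n ≤ #{v | v ∉ SV ∧ q < fV v / t} := by
    have hcov : SVᶜ ⊆ (univ.filter fun v => v ∉ SV ∧ fV v / t < q) ∪
        ((univ.filter fun v => v ∉ SV ∧ fV v / t = q) ∪
          univ.filter fun v => v ∉ SV ∧ q < fV v / t) := by
      intro v hv
      have hv' : v ∉ SV := by simpa using hv
      simp only [mem_union, mem_filter, mem_univ, true_and]
      rcases lt_trichotomy (fV v / t) q with h | h | h
      · exact Or.inl ⟨hv', h⟩
      · exact Or.inr (Or.inl ⟨hv', h⟩)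
      · exact Or.inr (Or.inr ⟨hv', h⟩)
    have h3 := (card_le_card hcov).trans ((card_union_le _ _).trans
      (Nat.add_le_add_left (card_union_le _ _) _))
    have h4 : (#SVᶜ : ℝ) ≤ #{v | v ∉ SV ∧ fV v / t < q} + (#{v | v ∉ SV ∧ fV v / t = q} +
      #{v | v ∉ SV ∧ q < fV v / t}) := by exact_mod_cast h3
    nlinarith
  -- With θn bad entries, or θn bad exits, a disperser edge would join a quotient above q to one at
  -- most q.
  refine ⟨q, hqL, ?_, ?_⟩
  · by_contra! hcon
    obtain ⟨v, hv, j, hj⟩ := h1 _ _ (by rw [hcard]; exact hcon) hq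
    obtain ⟨hv1, hv2⟩ := (mem_filter.1 hv).2
    obtain ⟨hj1, hj2⟩ := (mem_filter.1 hj).2
    have := Nat.div_le_div_right (c := t) (hIV v hv1 j hj1).le
    omega
  · by_contra! hcon
    obtain ⟨y, hy, j, hj⟩ := h2 _ _ hhi (by rw [hcard]; exact hcon)
    obtain ⟨hy1, hy2⟩ := (mem_filter.1 hy).2
    obtain ⟨hj1, hj2⟩ := (mem_filter.1 hj).2
    have := Nat.div_le_div_right (c := t) (hVO y hy1 j hj1).le
    omega

/-- The numbers of entries and exits on the wrong side of a separating value, or deleted, are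
controlled by the number of deleted vertices. -/
theorem exists_value_few_bad {V I : Type} [Fintype V] [Fintype I] [DecidableEq V]
    [DecidableEq I] [Nonempty V] (G : RankedDag V) {ρ θ : ℝ} {t d L : ℕ} (hθ : 0 < θ)
    (hθρ : 3 * θ ≤ ρ) (hρ1 : ρ ≤ 1) (ht : 1 ≤ t) (hG : G.IsRobust ρ t)
    (hcard : Fintype.card I = Fintype.card V) (nbr1 : V → Fin d → I) (nbr2 : I → Fin d → V)
    (h1 : ∀ (X : Finset I) (Y : Finset V), θ * Fintype.card I ≤ #X → θ * Fintype.card V ≤ #Y →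
      ∃ b ∈ Y, ∃ j, nbr1 b j ∈ X)
    (h2 : ∀ (X : Finset V) (Y : Finset I), θ * Fintype.card V ≤ #X → θ * Fintype.card I ≤ #Y →
      ∃ b ∈ Y, ∃ j, nbr2 b j ∈ X)
    (SI SO : Finset I) (SV : Finset V) (fI fO : I → ℕ) (fV : V → ℕ)
    (hV : ∀ v, v ∉ SV → ∀ u ∈ G.par v, u ∉ SV → fV u < fV v)
    (hIV : ∀ v, v ∉ SV → ∀ j, nbr1 v j ∉ SI → fI (nbr1 v j) < fV v)
    (hVO : ∀ y, y ∉ SO → ∀ j, nbr2 y j ∉ SV → fV (nbr2 y j) < fO y)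
    (hL0 : 0 < L) (hL : ∀ v, v ∉ SV → fV v < t * L) :
    ∃ q, q < L ∧
      θ * ((#{x | x ∈ SI ∨ q < fI x / t} : ℝ) + #{y | y ∈ SO ∨ fO y / t ≤ q}) ≤
        3 * θ ^ 2 * Fintype.card V + 2 * (#SI + #SV + #SO) := by
  have hn0 : (0 : ℝ) < Fintype.card V := by exact_mod_cast Fintype.card_pos
  -- With few deletions there are at most 3θn bad slots. With more than θn deletions, the trivial
  -- bound of 2n bad slots is paid for by the deletions, and any q will do.
  by_cases hS : (#SI + #SV + #SO : ℝ) ≤ θ * Fintype.card V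
  · obtain ⟨q, hqL, hI, hO⟩ := exists_separating_value G hθ hθρ hρ1 ht hG hcard nbr1 nbr2 h1 h2
      SI SO SV fI fO fV (by
        have : (0 : ℝ) ≤ #SI := Nat.cast_nonneg _
        have : (0 : ℝ) ≤ #SO := Nat.cast_nonneg _
        linarith) hV hIV hVO hL
    refine ⟨q, hqL, ?_⟩
    have hI' : (#{x | x ∈ SI ∨ q < fI x / t} : ℝ) ≤ #SI + #{x | x ∉ SI ∧ q < fI x / t} := by
      have : (univ.filter fun x => x ∈ SI ∨ q < fI x / t) ⊆
          SI ∪ univ.filter fun x => x ∉ SI ∧ q < fI x / t := by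
        intro x hx
        have := (mem_filter.1 hx).2
        by_cases hxS : x ∈ SI
        · exact mem_union_left _ hxS
        · exact mem_union_right _ (mem_filter.2 ⟨mem_univ _, hxS, this.resolve_left hxS⟩)
      exact_mod_cast (card_le_card this).trans (card_union_le _ _)
    have hO' : (#{y | y ∈ SO ∨ fO y / t ≤ q} : ℝ) ≤ #SO + #{y | y ∉ SO ∧ fO y / t ≤ q} := by
      have : (univ.filter fun y => y ∈ SO ∨ fO y / t ≤ q) ⊆
          SO ∪ univ.filter fun y => y ∉ SO ∧ fO y / t ≤ q := by
        intro x hx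
        have := (mem_filter.1 hx).2
        by_cases hxS : x ∈ SO
        · exact mem_union_left _ hxS
        · exact mem_union_right _ (mem_filter.2 ⟨mem_univ _, hxS, this.resolve_left hxS⟩)
      exact_mod_cast (card_le_card this).trans (card_union_le _ _)
    have h3 : (0 : ℝ) ≤ #SV := Nat.cast_nonneg _
    have h4 : (0 : ℝ) ≤ #SI := Nat.cast_nonneg _
    have h5 : (0 : ℝ) ≤ #SO := Nat.cast_nonneg _
    have h6 : (#{x | x ∈ SI ∨ q < fI x / t} : ℝ) + #{y | y ∈ SO ∨ fO y / t ≤ q} ≤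
        3 * (θ * Fintype.card V) := by linarith
    nlinarith
  · refine ⟨0, hL0, ?_⟩
    have hI : (#{x | x ∈ SI ∨ 0 < fI x / t} : ℝ) ≤ Fintype.card V := by
      rw [← hcard]; exact_mod_cast card_le_univ _
    have hO : (#{y | y ∈ SO ∨ fO y / t ≤ 0} : ℝ) ≤ Fintype.card V := by
      rw [← hcard]; exact_mod_cast card_le_univ _
    have h6 : θ * ((#{x | x ∈ SI ∨ 0 < fI x / t} : ℝ) + #{y | y ∈ SO ∨ fO y / t ≤ 0}) ≤
        θ * (Fintype.card V + Fintype.card V) := by gcongr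
    have h7 : 0 ≤ 3 * θ ^ 2 * (Fintype.card V : ℝ) := by positivity
    linarith

/-! ### Chains of copies indexed by bit strings. -/

/-- The number of bit strings that precede a given one lexicographically. -/
noncomputable def lexRank {k : ℕ} (i : Fin k → Bool) : ℕ :=
  Nat.card {j : Lex (Fin k → Bool) // j < toLex i}

theorem lexRank_lt {k : ℕ} {i j : Fin k → Bool} (h : toLex i < toLex j) : lexRank i < lexRank j := by
  have : Finite (Lex (Fin k → Bool)) := inferInstanceAs (Finite (Fin k → Bool))
  unfold lexRank
  rw [← Set.coe_ofPred, ← Set.coe_ofPred, Nat.card_coe_set_eq, Nat.card_coe_set_eq]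
  refine Set.ncard_lt_ncard ⟨fun x hx => lt_trans hx h, fun hsub => ?_⟩ (Set.toFinite _)
  exact lt_irrefl (toLex i) (hsub h)

theorem tailSwap_fst_lt {k : ℕ} (h : Fin k) (i z : Fin k → Bool) (hi : i h = true) :
    toLex (tailSwap h (i, z)).1 < toLex i := by
  refine ⟨h, fun j hj => ?_, ?_⟩
  · simp [tailSwap, show j < h from hj]
  · simp [tailSwap, hi]

/-- The entries (and exits) of a copy in a chain: `r` for each position and each bit string. -/
abbrev Slot (k r : ℕ) : Type := (Fin k × (Fin k → Bool)) × Fin r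

/-- The vertices of a chain: for each bit string entries, a copy of `V`, and exits. -/
abbrev ChainVertex (V : Type) (k r : ℕ) : Type := (Fin k → Bool) × (Slot k r ⊕ (V ⊕ Slot k r))

open scoped Classical in
/-- One copy of `G` between two dispersers for every bit string of length `k`; exits of copies are
joined to entries of lexicographically later copies. -/
noncomputable def RankedDag.chain {V : Type} [Fintype V] (G : RankedDag V) {k r d : ℕ}
    (nbr1 : V → Fin d → Slot k r) (nbr2 : Slot k r → Fin d → V) :
    RankedDag (ChainVertex V k r) where
  par
    | (i, .inl x) => if i x.1.1 = true then
        {((tailSwap x.1.1 (i, x.1.2)).1,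
          .inr (.inr ((x.1.1, (tailSwap x.1.1 (i, x.1.2)).2), x.2)))} else ∅
    | (i, .inr (.inl v)) => (G.par v).image (fun u => (i, .inr (.inl u))) ∪
        univ.image fun j => (i, .inl (nbr1 v j))
    | (i, .inr (.inr y)) => univ.image fun j => (i, .inr (.inl (nbr2 y j)))
  rank
    | (i, .inl _) => lexRank i * (univ.sup G.rank + 3)
    | (i, .inr (.inl v)) => lexRank i * (univ.sup G.rank + 3) + (G.rank v + 1)
    | (i, .inr (.inr _)) => lexRank i * (univ.sup G.rank + 3) + (univ.sup G.rank + 2)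
  rank_lt := by
    rintro ⟨i, x | v | y⟩ u hu
    · simp only at hu
      split_ifs at hu with hi
      · rw [mem_singleton] at hu
        subst hu
        simp only
        have := lexRank_lt (tailSwap_fst_lt x.1.1 i x.1.2 hi)
        have h2 := Nat.mul_le_mul_right (univ.sup G.rank + 3) (Nat.succ_le_of_lt this)
        rw [Nat.succ_mul] at h2
        omega
      · simp at hu
    · simp only [mem_union, mem_image, mem_univ, true_and] at hu
      rcases hu with ⟨w, hw, rfl⟩ | ⟨j, rfl⟩
      · have := G.rank_lt v w hw
        simp only
        omega
      · simp only
        omega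
    · simp only [mem_image, mem_univ, true_and] at hu
      obtain ⟨j, rfl⟩ := hu
      have := le_sup (f := G.rank) (mem_univ (nbr2 y j))
      simp only
      omega

theorem RankedDag.card_par_chain_le {V : Type} [Fintype V] (G : RankedDag V) {k r d δ : ℕ}
    (nbr1 : V → Fin d → Slot k r) (nbr2 : Slot k r → Fin d → V) (hδ : ∀ v, #(G.par v) ≤ δ) (w) :
    #((G.chain nbr1 nbr2).par w) ≤ δ + (d + 1) := by
  classical
  obtain ⟨i, x | v | y⟩ := w
  · simp only [RankedDag.chain]
    split_ifs
    · rw [card_singleton]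
      omega
    · simp
  · simp only [RankedDag.chain]
    refine (card_union_le _ _).trans ?_
    have h1 := hδ v
    refine (Nat.add_le_add card_image_le card_image_le).trans ?_
    rw [card_univ, Fintype.card_fin]
    omega
  · simp only [RankedDag.chain]
    refine card_image_le.trans ?_
    rw [card_univ, Fintype.card_fin]
    omega

/-- Every inversion is witnessed by `r` parallel edges between copies, each with a bad end. As
`tailSwap h` is an involution, different edges have different ends, so no bad slot is charged twice.
-/
theorem mul_inversions_le {k r : ℕ} (q : (Fin k → Bool) → ℕ)
    (badI badO : (Fin k → Bool) → Slot k r → Prop)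
    [∀ i, DecidablePred (badI i)] [∀ i, DecidablePred (badO i)]
    (h : ∀ i x, i x.1.1 = false → q (tailSwap x.1.1 (i, x.1.2)).1 ≤ q i →
      badO i x ∨ badI (tailSwap x.1.1 (i, x.1.2)).1
        ((x.1.1, (tailSwap x.1.1 (i, x.1.2)).2), x.2)) :
    r * inversions q ≤ ∑ i, (#{x | badI i x} + #{x | badO i x}) := by
  have hO : ∑ i, #{x | badO i x} = ∑ h : Fin k, ∑ c : Fin r, ∑ p : (Fin k → Bool) × (Fin k → Bool),
      if badO p.1 ((h, p.2), c) then 1 else 0 := by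
    simp only [card_filter, Fintype.sum_prod_type]
    rw [sum_comm]
    refine sum_congr rfl fun h _ => ?_
    rw [sum_comm' (t' := univ) (s' := fun _ => univ) (by simp)]
    rw [sum_comm]
    conv_rhs => rw [sum_comm]
    refine sum_congr rfl fun i _ => ?_
    exact sum_comm
  have hI : ∑ i, #{x | badI i x} = ∑ h : Fin k, ∑ c : Fin r, ∑ p : (Fin k → Bool) × (Fin k → Bool),
      if badI (tailSwap h p).1 ((h, (tailSwap h p).2), c) then 1 else 0 := by
    have h1 : ∀ (h : Fin k) (c : Fin r), (∑ p : (Fin k → Bool) × (Fin k → Bool),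
        if badI (tailSwap h p).1 ((h, (tailSwap h p).2), c) then 1 else 0) =
        ∑ p : (Fin k → Bool) × (Fin k → Bool), if badI p.1 ((h, p.2), c) then 1 else 0 :=
      fun h c => Equiv.sum_comp ((tailSwap_involutive h).toPerm _)
        (fun p : (Fin k → Bool) × (Fin k → Bool) => if badI p.1 ((h, p.2), c) then 1 else 0)
    simp only [h1]
    simp only [card_filter, Fintype.sum_prod_type]
    rw [sum_comm]
    refine sum_congr rfl fun h _ => ?_
    conv_rhs => rw [sum_comm]
    refine sum_congr rfl fun i _ => ?_
    exact sum_comm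
  have hr : r * inversions q = ∑ h : Fin k, ∑ _c : Fin r,
      ∑ p : (Fin k → Bool) × (Fin k → Bool),
        if p.1 h = false ∧ q (tailSwap h p).1 ≤ q p.1 then 1 else 0 := by
    simp only [sum_const, card_univ, Fintype.card_fin, smul_eq_mul, Fintype.sum_prod_type]
    rw [← mul_sum]
    rfl
  rw [sum_add_distrib, hO, hI, hr, ← sum_add_distrib]
  refine sum_le_sum fun l _ => ?_
  rw [← sum_add_distrib]
  refine sum_le_sum fun c _ => ?_
  rw [← sum_add_distrib]
  refine sum_le_sum fun p _ => ?_
  by_cases hp : p.1 l = false ∧ q (tailSwap l p).1 ≤ q p.1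
  · rw [if_pos hp]
    rcases h p.1 ((l, p.2), c) hp.1 hp.2 with h1 | h1
    · rw [if_pos (c := badO _ _) h1]
      omega
    · rw [if_pos (c := badI _ _) h1]
      omega
  · rw [if_neg hp]
    exact Nat.zero_le _

open scoped Classical in
theorem card_chain_finset {V : Type} [Fintype V] {k r : ℕ}
    (S : Finset (ChainVertex V k r)) :
    #S = ∑ i : Fin k → Bool, (#{x | (i, Sum.inl x) ∈ S} + #{v | (i, Sum.inr (Sum.inl v)) ∈ S} +
      #{y | (i, Sum.inr (Sum.inr y)) ∈ S}) := by
  have h1 : #S = ∑ w : ChainVertex V k r, if w ∈ S then 1 else 0 := by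
    rw [← card_filter, filter_mem_eq_inter, univ_inter]
  rw [h1, Fintype.sum_prod_type]
  refine sum_congr rfl fun i _ => ?_
  rw [Fintype.sum_sum_type, Fintype.sum_sum_type, card_filter, card_filter, card_filter, add_assoc]

/-- Labels below `t * L` would give every copy a value below `L`. Summing `exists_value_few_bad`
over the copies bounds the bad slots, hence the inversions of these values, and few inversions need
more than `L` values. -/
theorem RankedDag.isRobust_chain {V : Type} [Fintype V] [Nonempty V] (G : RankedDag V)
    {ρ θ η x : ℝ} {t k r d L : ℕ} (hθ : 0 < θ) (hθρ : 3 * θ ≤ ρ) (hρ1 : ρ ≤ 1) (ht : 1 ≤ t)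
    (hx : 0 < x) (hx1 : x ≤ 1) (hη : 0 < η) (hθη : θ ≤ η ^ 2) (hr : 1 ≤ r) (hL0 : 0 < L)
    (hL : L * (1 + x) ^ k < (2 * x ^ (2 * η)) ^ k)
    (hG : G.IsRobust ρ t) (hcard : Fintype.card V = k * 2 ^ k * r)
    (nbr1 : V → Fin d → Slot k r) (nbr2 : Slot k r → Fin d → V)
    (h1 : ∀ (X : Finset (Slot k r)) (Y : Finset V), θ * Fintype.card (Slot k r) ≤ #X →
      θ * Fintype.card V ≤ #Y → ∃ b ∈ Y, ∃ j, nbr1 b j ∈ X)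
    (h2 : ∀ (X : Finset V) (Y : Finset (Slot k r)), θ * Fintype.card V ≤ #X →
      θ * Fintype.card (Slot k r) ≤ #Y → ∃ b ∈ Y, ∃ j, nbr2 b j ∈ X) :
    (G.chain nbr1 nbr2).IsRobust (θ ^ 2 / 6) (t * L) := by
  classical
  intro S hS f hf
  by_contra! hcon
  have hcardI : Fintype.card (Slot k r) = Fintype.card V := by
    rw [hcard]; simp [Slot]
  have key : ∀ i : Fin k → Bool, ∃ q, q < L ∧
      θ * ((#{x | (i, Sum.inl x) ∈ S ∨ q < f (i, Sum.inl x) / t} : ℝ) +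
        #{y | (i, Sum.inr (Sum.inr y)) ∈ S ∨ f (i, Sum.inr (Sum.inr y)) / t ≤ q}) ≤
      3 * θ ^ 2 * Fintype.card V + 2 * ((#{x | (i, Sum.inl x) ∈ S} : ℝ) +
        #{v | (i, Sum.inr (Sum.inl v)) ∈ S} + #{y | (i, Sum.inr (Sum.inr y)) ∈ S}) := by
    intro i
    have := exists_value_few_bad G hθ hθρ hρ1 ht hG hcardI nbr1 nbr2 h1 h2
      {x | (i, Sum.inl x) ∈ S} {y | (i, Sum.inr (Sum.inr y)) ∈ S}
      {v | (i, Sum.inr (Sum.inl v)) ∈ S} (fun x => f (i, Sum.inl x))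
      (fun y => f (i, Sum.inr (Sum.inr y))) (fun v => f (i, Sum.inr (Sum.inl v)))
      (fun v hv u hu huS => by
        refine hf _ (by simpa using hv) _ ?_ (by simpa using huS)
        simp only [RankedDag.chain, mem_union, mem_image]
        exact Or.inl ⟨u, hu, rfl⟩)
      (fun v hv j hj => by
        refine hf _ (by simpa using hv) _ ?_ (by simpa using hj)
        simp only [RankedDag.chain, mem_union, mem_image]
        exact Or.inr ⟨j, mem_univ _, rfl⟩)
      (fun y hy j hj => by
        refine hf _ (by simpa using hy) _ ?_ (by simpa using hj)
        simp only [RankedDag.chain, mem_image]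
        exact ⟨j, mem_univ _, rfl⟩)
      hL0 (fun v hv => hcon _ (by simpa using hv))
    simpa only [mem_filter, mem_univ, true_and] using this
  choose q hqL hq using key
  have hwire := mul_inversions_le (r := r) q
    (fun i x => (i, Sum.inl x) ∈ S ∨ q i < f (i, Sum.inl x) / t)
    (fun i y => (i, Sum.inr (Sum.inr y)) ∈ S ∨ f (i, Sum.inr (Sum.inr y)) / t ≤ q i) (by
      intro i x hix hqi
      -- If both ends of the edge are good, then q of the earlier copy < exit quotient ≤ entry
      -- quotient ≤ q of the later copy.
      by_contra! hno
      obtain ⟨⟨hO1, hO2⟩, hI1, hI2⟩ := hno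
      have hedge := hf _ hI1 (i, Sum.inr (Sum.inr x)) (by
        have hσ : tailSwap x.1.1 (tailSwap x.1.1 (i, x.1.2)) = (i, x.1.2) :=
          tailSwap_involutive _ _
        have hbit : (tailSwap x.1.1 (i, x.1.2)).1 x.1.1 = true := by
          simp [tailSwap, hix]
        simp only [RankedDag.chain]
        rw [if_pos hbit, mem_singleton]
        simp only [Prod.mk.eta, hσ]) hO1
      have := Nat.div_le_div_right (c := t) hedge.le
      omega)
  have hSV : (Fintype.card (ChainVertex V k r) : ℝ) = 2 ^ k * (3 * Fintype.card V) := by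
    rw [Fintype.card_prod, Fintype.card_sum, Fintype.card_sum, hcardI]
    simp
    ring
  have hSsum : (#S : ℝ) = ∑ i : Fin k → Bool, ((#{x | (i, Sum.inl x) ∈ S} : ℝ) +
      #{v | (i, Sum.inr (Sum.inl v)) ∈ S} + #{y | (i, Sum.inr (Sum.inr y)) ∈ S}) := by
    rw [card_chain_finset S]
    push_cast
    rfl
  have hsum := sum_le_sum fun (i : Fin k → Bool) (_ : i ∈ univ) => hq i
  have hright : ∑ i : Fin k → Bool, (3 * θ ^ 2 * (Fintype.card V : ℝ) +
      2 * ((#{x | (i, Sum.inl x) ∈ S} : ℝ) + #{v | (i, Sum.inr (Sum.inl v)) ∈ S} +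
        #{y | (i, Sum.inr (Sum.inr y)) ∈ S})) =
      2 ^ k * (3 * θ ^ 2 * Fintype.card V) + 2 * #S := by
    rw [sum_add_distrib, sum_const, ← mul_sum, ← hSsum, card_univ, Fintype.card_fun,
      Fintype.card_bool, Fintype.card_fin, nsmul_eq_mul]
    push_cast
    rfl
  rw [← mul_sum, hright] at hsum
  have hwire' : (r : ℝ) * inversions q ≤ ∑ i : Fin k → Bool,
      ((#{x | (i, Sum.inl x) ∈ S ∨ q i < f (i, Sum.inl x) / t} : ℝ) +
        #{y | (i, Sum.inr (Sum.inr y)) ∈ S ∨ f (i, Sum.inr (Sum.inr y)) / t ≤ q i}) := by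
    exact_mod_cast hwire
  rw [hSV] at hS
  have hVr : (Fintype.card V : ℝ) = k * 2 ^ k * r := by rw [hcard]; push_cast; ring
  have hr' : (1 : ℝ) ≤ r := by exact_mod_cast hr
  have hinv : (inversions q : ℝ) ≤ 4 * η ^ 2 * k * 4 ^ k := by
    -- The chain has 3 * 2^k * |V| vertices, so 2 * #S ≤ θ² 2^k |V|; with the term 3θ² 2^k |V| this
    -- makes 4θ² 2^k |V|, where |V| = k 2^k r.
    have h3 : θ * (r * inversions q) ≤ θ * r * (4 * θ * k * 4 ^ k) := by
      refine (mul_le_mul_of_nonneg_left hwire' hθ.le).trans (hsum.trans ?_)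
      rw [hVr] at hS ⊢
      rw [show (4 : ℝ) ^ k = 2 ^ k * 2 ^ k by rw [← mul_pow]; norm_num]
      nlinarith
    have h4 : (inversions q : ℝ) ≤ 4 * θ * k * 4 ^ k := by
      have h5 : 0 < θ * r := by positivity
      rw [← mul_assoc] at h3
      exact le_of_mul_le_mul_left h3 h5
    refine h4.trans ?_
    gcongr
  have := pow_le_card_values_of_inversions_le hx hx1 hη q hqL hinv
  linarith

/-! ### Iterating the chain construction. -/

/-- A fixed trade-off exponent can be reached by functions on bit strings with few inversions. -/
theorem exists_inversion_parameters {a : ℕ} (ha : 1 ≤ a) :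
    ∃ x η : ℝ, 0 < x ∧ x ≤ 1 ∧ 0 < η ∧ η ≤ 1 ∧
      ∀ m : ℕ, 1 ≤ m → ((2 ^ ((a - 1) * m) : ℕ) : ℝ) * (1 + x) ^ (a * m) <
        (2 * x ^ (2 * η)) ^ (a * m) := by
  -- The claim is the m-th power of 2^(a-1) (1+x)^a < (2 x^(2η))^a. First x is fixed with (1+x)^a <
  -- 2, then η is taken so small that x^(2η) is close to 1.
  obtain ⟨x, hx, hx1, hxa⟩ : ∃ x : ℝ, 0 < x ∧ x ≤ 1 ∧ (1 + x) ^ a < 2 := by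
    have hc : Filter.Tendsto (fun x : ℝ => (1 + x) ^ a) (nhdsWithin 0 (Set.Ioi 0)) (nhds 1) := by
      have : Continuous fun x : ℝ => (1 + x) ^ a := by fun_prop
      have h := (this.tendsto 0).mono_left (nhdsWithin_le_nhds (s := Set.Ioi 0))
      simpa using h
    have h1 := hc.eventually (gt_mem_nhds (show (1 : ℝ) < 2 by norm_num))
    have h2 : ∀ᶠ x : ℝ in nhdsWithin 0 (Set.Ioi 0), x ∈ Set.Ioc (0 : ℝ) 1 :=
      Ioc_mem_nhdsGT (by norm_num)
    obtain ⟨x, h3, h4⟩ := (h1.and h2).exists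
    exact ⟨x, h4.1, h4.2, h3⟩
  obtain ⟨η, hη, hη1, hηa⟩ : ∃ η : ℝ, 0 < η ∧ η ≤ 1 ∧ (1 + x) ^ a < 2 * (x ^ (2 * η)) ^ a := by
    have hc : Filter.Tendsto (fun η : ℝ => 2 * (x ^ (2 * η)) ^ a) (nhdsWithin 0 (Set.Ioi 0))
        (nhds 2) := by
      have : Continuous fun η : ℝ => 2 * (x ^ (2 * η)) ^ a := by
        have : Continuous fun η : ℝ => x ^ (2 * η) :=
          Continuous.rpow continuous_const (by fun_prop) fun _ => Or.inl hx.ne'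
        fun_prop
      have h := (this.tendsto 0).mono_left (nhdsWithin_le_nhds (s := Set.Ioi 0))
      simpa using h
    have h1 := hc.eventually (lt_mem_nhds hxa)
    have h2 : ∀ᶠ η : ℝ in nhdsWithin 0 (Set.Ioi 0), η ∈ Set.Ioc (0 : ℝ) 1 :=
      Ioc_mem_nhdsGT (by norm_num)
    obtain ⟨η, h3, h4⟩ := (h1.and h2).exists
    exact ⟨η, h4.1, h4.2, h3⟩
  refine ⟨x, η, hx, hx1, hη, hη1, fun m hm => ?_⟩
  have h1 : (2 : ℝ) ^ (a - 1) * (1 + x) ^ a < (2 * x ^ (2 * η)) ^ a := by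
    have h2 : (2 : ℝ) ^ a = 2 ^ (a - 1) * 2 := by
      rw [← pow_succ, Nat.sub_add_cancel ha]
    rw [mul_pow, h2, mul_assoc]
    exact mul_lt_mul_of_pos_left hηa (by positivity)
  push_cast
  rw [pow_mul, pow_mul, pow_mul, ← mul_pow]
  exact pow_lt_pow_left₀ h1 (by positivity) (by omega)

/-- What matters is the order of quantifiers: `d` and `ρ'` depend on `ρ` and `a` only, so they serve
chains of every length `k = a * m`. -/
theorem exists_robust_step {ρ : ℝ} (hρ : 0 < ρ) (hρ1 : ρ ≤ 1) {a : ℕ} (ha : 1 ≤ a) :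
    ∃ (d : ℕ) (ρ' : ℝ), 0 < ρ' ∧ ρ' ≤ 1 ∧ ∀ (m r t δ : ℕ) (V : Type) [Fintype V] (G : RankedDag V),
      1 ≤ m → 1 ≤ r → 1 ≤ t → Fintype.card V = a * m * 2 ^ (a * m) * r →
      (∀ v, #(G.par v) ≤ δ) → G.IsRobust ρ t →
      ∃ (W : Type) (_ : Fintype W) (H : RankedDag W),
        Fintype.card W = 3 * 2 ^ (a * m) * Fintype.card V ∧ (∀ w, #(H.par w) ≤ δ + d) ∧
        H.IsRobust ρ' (t * 2 ^ ((a - 1) * m)) := by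
  obtain ⟨x, η, hx, hx1, hη, hη1, hL⟩ := exists_inversion_parameters ha
  have hθ : 0 < min (ρ / 3) (η ^ 2) := by positivity
  have hθρ : 3 * min (ρ / 3) (η ^ 2) ≤ ρ := by
    have := min_le_left (ρ / 3) (η ^ 2)
    linarith
  have hθη := min_le_right (ρ / 3) (η ^ 2)
  set θ := min (ρ / 3) (η ^ 2) with hθdef
  have hθ1 : θ ≤ 1 := by linarith
  obtain ⟨d, hd⟩ := exists_disperser hθ hθ1 1
  refine ⟨d + 1, θ ^ 2 / 6, by positivity, by nlinarith, ?_⟩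
  intro m r t δ V _ G hm hr ht hcard hδ hG
  have hcardI : Fintype.card (Slot (a * m) r) = Fintype.card V := by
    rw [hcard]; simp [Slot]
  have hpos : 0 < Fintype.card V := by
    rw [hcard]
    positivity
  have : Nonempty V := Fintype.card_pos_iff.1 hpos
  have : Nonempty (Slot (a * m) r) := Fintype.card_pos_iff.1 (hcardI ▸ hpos)
  obtain ⟨nbr1, h1⟩ := hd (Slot (a * m) r) V (by omega)
  obtain ⟨nbr2, h2⟩ := hd V (Slot (a * m) r) (by omega)
  refine ⟨_, inferInstance, G.chain nbr1 nbr2, ?_, G.card_par_chain_le nbr1 nbr2 hδ, ?_⟩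
  · rw [Fintype.card_prod, Fintype.card_sum, Fintype.card_sum, hcardI]
    simp
    ring
  · exact G.isRobust_chain hθ hθρ hρ1 ht hx hx1 hη hθη hr (by positivity) (hL m hm) hG hcard
      nbr1 nbr2 h1 h2

/-- A perfect matching, directed from one side to the other. -/
def RankedDag.matching (n : ℕ) : RankedDag (Fin n × Bool) where
  par v := bif v.2 then {(v.1, false)} else ∅
  rank v := bif v.2 then 1 else 0
  rank_lt := by
    rintro ⟨a, _ | _⟩ u hu
    · simp at hu
    · simp only [cond_true, mem_singleton] at hu
      subst hu
      simp

theorem RankedDag.isRobust_matching {n : ℕ} (hn : 1 ≤ n) :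
    (RankedDag.matching n).IsRobust (1 / 4) 1 := by
  intro S hS f hf
  have hS' : #S < n := by
    have h1 : (#S : ℝ) < n := by
      refine hS.trans_lt ?_
      have : (1 : ℝ) ≤ n := by exact_mod_cast hn
      simp only [Fintype.card_prod, Fintype.card_fin, Fintype.card_bool, Nat.cast_mul,
        Nat.cast_ofNat]
      linarith
    exact_mod_cast h1
  obtain ⟨a, -, ha⟩ := exists_mem_notMem_of_card_lt_card (s := S.image Prod.fst)
    (t := (univ : Finset (Fin n))) (by
      rw [card_univ, Fintype.card_fin]
      exact card_image_le.trans_lt hS')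
  have hno : ∀ b, (a, b) ∉ S := fun b hb => ha (mem_image.2 ⟨_, hb, rfl⟩)
  refine ⟨(a, true), hno _, ?_⟩
  have := hf (a, true) (hno _) (a, false) (by simp [RankedDag.matching]) (hno _)
  omega

/-- All steps use the same `k = a * m`. The factor k 2^k is built into the initial matching, so the
size keeps the form k 2^k r that the next step needs. -/
theorem exists_robust {a : ℕ} (ha : 1 ≤ a) (l : ℕ) :
    ∃ (δ : ℕ) (ρ : ℝ), 0 < ρ ∧ ρ ≤ 1 ∧ ∀ m : ℕ, 1 ≤ m →
      ∃ (V : Type) (_ : Fintype V) (G : RankedDag V),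
        Fintype.card V = a * m * 2 ^ (a * m) * (2 * (3 * 2 ^ (a * m)) ^ l) ∧
        (∀ v, #(G.par v) ≤ δ) ∧ G.IsRobust ρ (2 ^ ((a - 1) * m * l)) := by
  induction l with
  | zero =>
    refine ⟨1, 1 / 4, by norm_num, by norm_num, fun m hm => ?_⟩
    refine ⟨_, inferInstance, RankedDag.matching (a * m * 2 ^ (a * m)), by simp, fun v => ?_, ?_⟩
    · obtain ⟨v, _ | _⟩ := v <;> simp [RankedDag.matching]
    · simpa using RankedDag.isRobust_matching (n := a * m * 2 ^ (a * m)) (by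
        have : 0 < a * m * 2 ^ (a * m) := by positivity
        omega)
  | succ l ih =>
    obtain ⟨δ, ρ, hρ, hρ1, h⟩ := ih
    obtain ⟨d, ρ', hρ', hρ1', hstep⟩ := exists_robust_step hρ hρ1 ha
    refine ⟨δ + d, ρ', hρ', hρ1', fun m hm => ?_⟩
    obtain ⟨V, _, G, hcard, hδ, hG⟩ := h m hm
    obtain ⟨W, hW, H, hWcard, hHδ, hH⟩ := hstep m (2 * (3 * 2 ^ (a * m)) ^ l) _ δ V G hm
      (Nat.succ_le_of_lt (by positivity)) (Nat.one_le_two_pow) hcard hδ hG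
    refine ⟨W, hW, H, ?_, hHδ, ?_⟩
    · rw [hWcard, hcard, pow_succ]
      ring
    · rw [Nat.mul_succ, pow_add]
      exact hH

/-! ### Connectors of linear size. -/

/-- Whatever set `S` is deleted, at most `#S` outputs fail to be reached from any given set `X` of
at least half of the inputs. Reachability is expressed by sets `Z` closed under edges avoiding
`S`. -/
def RankedDag.IsConnector {n : ℕ} {Y : Type} (G : RankedDag (Fin (16 * n) ⊕ Y))
    (out : Fin n → Fin (16 * n) ⊕ Y) : Prop :=
  ∀ (S : Finset (Fin (16 * n) ⊕ Y)) (Z : Set (Fin (16 * n) ⊕ Y)),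
    (∀ v, v ∉ S → ∀ u ∈ G.par v, u ∈ Z → v ∈ Z) →
    ∀ X : Finset (Fin (16 * n)), 8 * n ≤ #X → (∀ x ∈ X, Sum.inl x ∈ Z) →
    ∀ C : Finset (Fin n), (∀ c ∈ C, out c ∉ Z) → #C ≤ #S

open scoped Classical in
/-- The complete bipartite digraph from `m` inputs to `n` outputs. -/
noncomputable def RankedDag.completeBipartite (m n : ℕ) : RankedDag (Fin m ⊕ Fin n) where
  par
    | .inl _ => ∅
    | .inr _ => univ.image Sum.inl
  rank
    | .inl _ => 0
    | .inr _ => 1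
  rank_lt := by
    rintro (v | v) u hu
    · simp at hu
    · simp only [mem_image, mem_univ, true_and] at hu
      obtain ⟨j, rfl⟩ := hu
      simp

open scoped Classical in
/-- Feed the inputs of `G` and `n` new outputs from `m` new inputs, and join the old outputs to the
new ones. -/
noncomputable def RankedDag.extendConnector {m m' n n' d e : ℕ} {Y : Type} [Fintype Y]
    (G : RankedDag (Fin m' ⊕ Y)) (out : Fin n' → Fin m' ⊕ Y) (nbrI : Fin m' → Fin d → Fin m)
    (nbrC : Fin n → Fin d → Fin m) (nbrO : Fin n → Fin e → Fin n') :
    RankedDag (Fin m ⊕ ((Fin m' ⊕ Y) ⊕ Fin n)) where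
  par
    | .inl _ => ∅
    | .inr (.inl (.inl x)) => univ.image fun j => .inl (nbrI x j)
    | .inr (.inl (.inr y)) => (G.par (.inr y)).image fun u => .inr (.inl u)
    | .inr (.inr c) => univ.image (fun j => .inl (nbrC c j)) ∪
        univ.image fun j => .inr (.inl (out (nbrO c j)))
  rank
    | .inl _ => 0
    | .inr (.inl v) => G.rank v + 1
    | .inr (.inr _) => univ.sup G.rank + 2
  rank_lt := by
    rintro (v | (v | v) | v) u hu
    · simp at hu
    · simp only [mem_image, mem_univ, true_and] at hu
      obtain ⟨j, rfl⟩ := hu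
      simp
    · simp only [mem_image] at hu
      obtain ⟨j, hj, rfl⟩ := hu
      have := G.rank_lt _ _ hj
      simp only
      omega
    · simp only [mem_union, mem_image, mem_univ, true_and] at hu
      rcases hu with ⟨j, rfl⟩ | ⟨j, rfl⟩
      · simp
      · have := le_sup (f := G.rank) (mem_univ (out (nbrO v j)))
        simp only
        omega

theorem card_add_card_le_of_inl_of_inr {A B : Type*} {S : Finset (A ⊕ B)} {s : Finset A}
    {t : Finset B} (hs : ∀ a ∈ s, Sum.inl a ∈ S) (ht : ∀ b ∈ t, Sum.inr b ∈ S) :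
    #s + #t ≤ #S := by
  rw [← card_disjSum]
  refine card_le_card fun x hx => ?_
  rcases x with a | b
  · exact hs a (by simpa using hx)
  · exact ht b (by simpa using hx)

/-- Surviving outputs that are not reached are so few that Hall's theorem matches them to inner
outputs. These are not reached either, so induction bounds them by the deletions inside; deleted new
outputs pay for themselves. No constant is lost. -/
theorem RankedDag.isConnector_extendConnector {n n' d e : ℕ} {Y : Type} [Fintype Y]
    (hn : n ≤ 2 * n' + 1)
    (G : RankedDag (Fin (16 * n') ⊕ Y)) (out : Fin n' → Fin (16 * n') ⊕ Y)
    (hG : G.IsConnector out) (hin : ∀ x, G.par (Sum.inl x) = ∅)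
    (nbrI : Fin (16 * n') → Fin d → Fin (16 * n))
    (nbrC : Fin n → Fin d → Fin (16 * n)) (nbrO : Fin n → Fin e → Fin n')
    (hI : ∀ (X : Finset (Fin (16 * n))) (W : Finset (Fin (16 * n'))), n ≤ #X → n' ≤ #W →
      ∃ b ∈ W, ∃ j, nbrI b j ∈ X)
    (hC : ∀ (X : Finset (Fin (16 * n))) (W : Finset (Fin n)), n ≤ #X → n ≤ 16 * #W →
      ∃ b ∈ W, ∃ j, nbrC b j ∈ X)
    (hO : ∀ E : Finset (Fin n), 16 * #E ≤ 3 * n' → #E ≤ #(E.biUnion fun b => univ.image (nbrO b))) :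
    (G.extendConnector out nbrI nbrC nbrO).IsConnector fun c => Sum.inr (Sum.inr c) := by
  classical
  intro S Z hZ X hX hXZ C hCZ
  by_cases hSn : n ≤ #S
  · exact (card_le_univ C).trans (by rwa [Fintype.card_fin])
  rw [not_le] at hSn
  have hXn : n ≤ #X := by omega
  let S' : Finset (Fin (16 * n') ⊕ Y) := {w | Sum.inr (Sum.inl w) ∈ S}
  let SI : Finset (Fin (16 * n')) := {x | Sum.inr (Sum.inl (Sum.inl x)) ∈ S}
  let SC : Finset (Fin n) := {c | Sum.inr (Sum.inr c) ∈ S}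
  have hS' : ∀ w, w ∈ S' ↔ Sum.inr (Sum.inl w) ∈ S := fun w => by simp [S']
  have hSI : ∀ x, x ∈ SI ↔ Sum.inr (Sum.inl (Sum.inl x)) ∈ S := fun w => by simp [SI]
  have hSC : ∀ c, c ∈ SC ↔ Sum.inr (Sum.inr c) ∈ S := fun w => by simp [SC]
  have hcard : #S' + #SC ≤ #S := by
    have h1 := card_add_card_le_of_inl_of_inr (S := S) (s := ∅) (t := S'.disjSum SC) (by simp) (by
      rintro (w | c) hw
      · exact (hS' w).1 (by simpa using hw)
      · exact (hSC c).1 (by simpa using hw))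
    rw [card_disjSum] at h1
    omega
  have hcardI : #SI ≤ #S' := by
    have := card_add_card_le_of_inl_of_inr (S := S') (s := SI) (t := ∅)
      (fun x hx => (hS' _).2 ((hSI x).1 hx)) (by simp)
    omega
  let Z' : Set (Fin (16 * n') ⊕ Y) := {w | Sum.inr (Sum.inl w) ∈ Z}
  have hclosed : ∀ v, v ∉ S' → ∀ u ∈ G.par v, u ∈ Z' → v ∈ Z' := by
    rintro (x | y) hv u hu huZ
    · rw [hin] at hu
      simp at hu
    · refine hZ _ (fun h => hv ((hS' _).2 h)) _ ?_ huZ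
      simp only [RankedDag.extendConnector, mem_image]
      exact ⟨u, hu, rfl⟩
  let X' : Finset (Fin (16 * n')) := {x | Sum.inl x ∈ Z'}
  -- Fewer than n' inner inputs survive unreached, and at most #S ≤ n - 1 ≤ 2n' are deleted.
  have hX' : 8 * n' ≤ #X' := by
    have hlt : #(X'ᶜ \ SI) < n' := by
      by_contra! hcon
      obtain ⟨b, hb, j, hj⟩ := hI X _ hXn hcon
      obtain ⟨hb1, hb2⟩ := mem_sdiff.1 hb
      refine (mem_compl.1 hb1) (mem_filter.2 ⟨mem_univ _,
        hZ _ (fun h => hb2 ((hSI b).2 h)) (Sum.inl (nbrI b j)) ?_ (hXZ _ hj)⟩)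
      simp only [RankedDag.extendConnector, mem_image]
      exact ⟨j, mem_univ _, rfl⟩
    have h1 := le_card_sdiff SI X'ᶜ
    rw [card_compl, Fintype.card_fin] at h1
    omega
  let E : Finset (Fin n) := C \ SC
  have hEmem : ∀ c ∈ E, (Sum.inr (Sum.inr c) : Fin (16 * n) ⊕ ((Fin (16 * n') ⊕ Y) ⊕ Fin n)) ∉ S ∧
      (Sum.inr (Sum.inr c) : Fin (16 * n) ⊕ ((Fin (16 * n') ⊕ Y) ⊕ Fin n)) ∉ Z := by
    intro c hc
    obtain ⟨h1, h2⟩ := mem_sdiff.1 hc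
    exact ⟨fun h => h2 ((hSC c).2 h), hCZ c h1⟩
  have hEcard : 16 * #E < n := by
    by_contra! hcon
    obtain ⟨b, hb, j, hj⟩ := hC X E hXn hcon
    obtain ⟨hb1, hb2⟩ := hEmem b hb
    refine hb2 (hZ _ hb1 (Sum.inl (nbrC b j)) ?_ (hXZ _ hj))
    simp only [RankedDag.extendConnector, mem_union, mem_image]
    exact Or.inl ⟨j, mem_univ _, rfl⟩
  obtain ⟨f, hf, hfmem⟩ := (Finset.all_card_le_biUnion_card_iff_exists_injective
    (fun c : E => univ.image (nbrO c))).1 (by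
      intro s
      have h1 : #(s.map (Function.Embedding.subtype _)) ≤ #E := by
        refine card_le_card fun c hc => ?_
        obtain ⟨c', _, rfl⟩ := mem_map.1 hc
        exact c'.2
      have h2 := hO (s.map (Function.Embedding.subtype _)) (by omega)
      rw [card_map] at h2
      refine h2.trans (card_le_card fun c hc => ?_)
      simp only [mem_biUnion, mem_map] at hc ⊢
      obtain ⟨_, ⟨b, hb, rfl⟩, h3⟩ := hc
      exact ⟨b, hb, h3⟩)
  have hEle : #E ≤ #S' := by
    have h1 : #E = #(univ.image f) := by
      rw [card_image_of_injective _ hf, card_univ, Fintype.card_coe]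
    rw [h1]
    refine hG S' Z' hclosed X' hX' (fun x hx => (mem_filter.1 hx).2) _ fun c' hc' hmem => ?_
    obtain ⟨c, _, rfl⟩ := mem_image.1 hc'
    obtain ⟨j, _, hj⟩ := mem_image.1 (hfmem c)
    obtain ⟨hb1, hb2⟩ := hEmem c c.2
    refine hb2 (hZ _ hb1 (Sum.inr (Sum.inl (out (f c)))) ?_ hmem)
    simp only [RankedDag.extendConnector, mem_union, mem_image]
    exact Or.inr ⟨j, mem_univ _, by rw [hj]⟩
  have h5 : #C ≤ #E + #SC := by
    have := le_card_sdiff SC C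
    change #C - #SC ≤ #E at this
    omega
  omega

/-- Connectors of linear size and bounded indegree exist. -/
theorem exists_connector : ∃ δ : ℕ, ∀ n : ℕ,
    ∃ (Y : Type) (_ : Fintype Y) (G : RankedDag (Fin (16 * n) ⊕ Y))
      (out : Fin n → Fin (16 * n) ⊕ Y), Function.Injective out ∧ Fintype.card Y ≤ 18 * n ∧
      (∀ x, G.par (Sum.inl x) = ∅) ∧ (∀ v, #(G.par v) ≤ δ) ∧ G.IsConnector out := by
  classical
  obtain ⟨d, hd⟩ := exists_disperser (θ := 1 / 16) (by norm_num) (by norm_num) 16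
  obtain ⟨e, he⟩ := exists_expander
  refine ⟨d + e + 16, fun n => ?_⟩
  induction n using Nat.strong_induction_on with
  | _ n ih =>
    rcases Nat.lt_or_ge n 2 with hn | hn
    · refine ⟨Fin n, inferInstance, RankedDag.completeBipartite (16 * n) n, Sum.inr,
        Sum.inr_injective, by rw [Fintype.card_fin]; omega, fun _ => rfl, ?_, ?_⟩
      · rintro (v | v)
        · simp [RankedDag.completeBipartite]
        · simp only [RankedDag.completeBipartite]
          refine card_image_le.trans ?_
          rw [card_univ, Fintype.card_fin]
          omega
      · intro S Z hZ X hX hXZ C hCZ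
        rcases Finset.eq_empty_or_nonempty S with rfl | hS
        · rw [card_empty, Nat.le_zero, card_eq_zero, eq_empty_iff_forall_notMem]
          intro c hc
          have hc2 := c.2
          obtain ⟨x, hx⟩ := card_pos.1 (show 0 < #X by omega)
          refine hCZ c hc (hZ _ (by simp) (Sum.inl x) ?_ (hXZ x hx))
          simp only [RankedDag.completeBipartite, mem_image]
          exact ⟨x, mem_univ _, rfl⟩
        · have h1 := card_le_univ C
          rw [Fintype.card_fin] at h1
          have h2 := card_pos.2 hS
          omega
    · obtain ⟨Y, hY, G, out, hout, hcard, hin, hδ, hG⟩ := ih (n / 2) (by omega)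
      have hn' : 1 ≤ n / 2 := by omega
      have : Nonempty (Fin (16 * n)) := ⟨⟨0, by omega⟩⟩
      have : Nonempty (Fin (n / 2)) := ⟨⟨0, by omega⟩⟩
      obtain ⟨nbrI, hI⟩ := hd (Fin (16 * n)) (Fin (16 * (n / 2))) (by
        rw [Fintype.card_fin, Fintype.card_fin]; omega)
      obtain ⟨nbrC, hC⟩ := hd (Fin (16 * n)) (Fin n) (by
        rw [Fintype.card_fin, Fintype.card_fin])
      obtain ⟨nbrO, hO⟩ := he (Fin (n / 2)) (Fin n) (by
        rw [Fintype.card_fin, Fintype.card_fin]; omega)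
      have hscale : ∀ a : ℕ, (1 / 16 : ℝ) * ((16 * a : ℕ) : ℝ) = a := fun a => by
        push_cast
        ring
      refine ⟨(Fin (16 * (n / 2)) ⊕ Y) ⊕ Fin n, inferInstance,
        G.extendConnector out nbrI nbrC nbrO, fun c => Sum.inr (Sum.inr c),
        Sum.inr_injective.comp Sum.inr_injective, ?_, fun _ => rfl, ?_, ?_⟩
      -- The size recursion closes at 18: with n' = n/2 rounded down, 16n' + 18n' + n ≤ 18n.
      · rw [Fintype.card_sum, Fintype.card_sum, Fintype.card_fin, Fintype.card_fin]
        omega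
      · rintro (v | (v | v) | v)
        · simp [RankedDag.extendConnector]
        · simp only [RankedDag.extendConnector]
          refine card_image_le.trans ?_
          rw [card_univ, Fintype.card_fin]
          omega
        · simp only [RankedDag.extendConnector]
          exact card_image_le.trans (hδ _)
        · simp only [RankedDag.extendConnector]
          refine (card_union_le _ _).trans ((Nat.add_le_add card_image_le card_image_le).trans ?_)
          rw [card_univ, card_univ, Fintype.card_fin, Fintype.card_fin]
          omega
      · refine RankedDag.isConnector_extendConnector (by omega) G out hG hin nbrI nbrC nbrO
          ?_ ?_ ?_
        · intro X W hX hW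
          refine hI X W ?_ ?_
          · rw [Fintype.card_fin, hscale]
            exact_mod_cast hX
          · rw [Fintype.card_fin, hscale]
            exact_mod_cast hW
        · intro X W hX hW
          refine hC X W ?_ ?_
          · rw [Fintype.card_fin, hscale]
            exact_mod_cast hX
          · rw [Fintype.card_fin]
            have : (n : ℝ) ≤ 16 * #W := by exact_mod_cast hW
            linarith
        · intro E hE
          have := hO E (by rw [Fintype.card_fin]; exact hE)
          convert this

/-! ### Numerical parameters. -/

/-- The size after `a` steps is 2^(m(a²+a)) up to the factor 2a 3^a m, and the depth is 2^(m(a²-a));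
the ratio of the exponents tends to 1 as `a` grows. -/
theorem exists_size_parameters {ε : ℝ} (hε : 0 < ε) :
    ∃ a : ℕ, 1 ≤ a ∧ ∀ ρ : ℝ, 0 < ρ → ρ ≤ 1 → ∃ c : ℕ, ∀ N : ℕ, 1 ≤ N → ∃ m n : ℕ, 1 ≤ m ∧
      n = a * m * 2 ^ (a * m) * (2 * (3 * 2 ^ (a * m)) ^ a) ∧
      2 * (N : ℝ) ≤ ρ * n ∧ n ≤ c * N ∧
      (N : ℝ) ^ (1 - ε) ≤ ((2 ^ ((a - 1) * m * a) : ℕ) : ℝ) := by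
  obtain ⟨a', ha'⟩ := exists_nat_ge (3 / ε)
  set a := a' + 1 with ha
  have haε : 3 ≤ ε * a := by
    rw [div_le_iff₀ hε] at ha'
    push_cast [ha]
    nlinarith
  refine ⟨a, by omega, fun ρ hρ hρ1 => ?_⟩
  let n : ℕ → ℕ := fun m => a * m * 2 ^ (a * m) * (2 * (3 * 2 ^ (a * m)) ^ a)
  -- From `m0` on, the factor 2a 3^a m is absorbed by one more 2^m.
  obtain ⟨m0, hm01, hm0⟩ : ∃ m0 : ℕ, 1 ≤ m0 ∧ ∀ m, m0 ≤ m → 2 * a * 3 ^ a * m ≤ 2 ^ m := by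
    have h1 := tendsto_pow_const_div_const_pow_of_one_lt 1 (show (1 : ℝ) < 2 by norm_num)
    have h2 := h1.eventually (gt_mem_nhds (show (0 : ℝ) < 1 / (2 * a * 3 ^ a) by
      have : (0 : ℝ) < a := by rw [ha]; positivity
      positivity))
    obtain ⟨m0, h3⟩ := Filter.eventually_atTop.1 h2
    refine ⟨m0 + 1, by omega, fun m hm => ?_⟩
    have h4 := h3 m (by omega)
    have ha0 : (0 : ℝ) < a := by rw [ha]; positivity
    rw [pow_one, div_lt_div_iff₀ (by positivity) (by positivity), one_mul] at h4
    have h5 : ((2 * a * 3 ^ a * m : ℕ) : ℝ) ≤ ((2 ^ m : ℕ) : ℝ) := by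
      push_cast
      linarith
    exact_mod_cast h5
  have hnm : ∀ m, m ≤ n m := fun m => by
    have h1 : 0 < 2 ^ (a * m) * (2 * (3 * 2 ^ (a * m)) ^ a) := by positivity
    calc m = 1 * m * 1 := by ring
      _ ≤ a * m * (2 ^ (a * m) * (2 * (3 * 2 ^ (a * m)) ^ a)) :=
          Nat.mul_le_mul (Nat.mul_le_mul_right _ (by omega)) h1
      _ = n m := by simp only [n]; ring
  have hgrow : ∀ m, 1 ≤ m → n (m + 1) ≤ 2 ^ (1 + a + a * a) * n m := by
    intro m hm
    have h1 : n (m + 1) = (m + 1) * (a * 2 ^ (a * m) * (2 * (3 * 2 ^ (a * m)) ^ a)) *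
        2 ^ (a + a * a) := by
      simp only [n]
      rw [show a * (m + 1) = a * m + a by ring, pow_add 2 (a * m) a, pow_add 2 a (a * a),
        pow_mul 2 a a, ← mul_assoc 3, mul_pow (3 * 2 ^ (a * m)) (2 ^ a) a]
      generalize a = b
      ring
    have h2 : 2 ^ (1 + a + a * a) * n m = (2 * m) * (a * 2 ^ (a * m) *
        (2 * (3 * 2 ^ (a * m)) ^ a)) * 2 ^ (a + a * a) := by
      simp only [n]
      rw [add_assoc, pow_add 2 1]
      ring
    rw [h1, h2]
    exact Nat.mul_le_mul_right _ (Nat.mul_le_mul_right _ (by omega))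
  obtain ⟨c', hc'⟩ := exists_nat_ge (2 ^ (1 + a + a * a) * (2 / ρ) : ℝ)
  refine ⟨c' + n m0, fun N hN => ?_⟩
  have hN1 : (1 : ℝ) ≤ N := by exact_mod_cast hN
  have hex : ∃ m, m0 ≤ m ∧ 2 * (N : ℝ) ≤ ρ * n m := by
    obtain ⟨m, hm⟩ := exists_nat_ge (2 * N / ρ : ℝ)
    refine ⟨max m m0, le_max_right _ _, ?_⟩
    rw [div_le_iff₀ hρ, mul_comm (m : ℝ)] at hm
    refine hm.trans (mul_le_mul_of_nonneg_left ?_ hρ.le)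
    exact_mod_cast (le_max_left m m0).trans (hnm _)
  classical
  -- By minimality and `hgrow`, n m exceeds 2N/ρ by a constant factor at most, unless m = m0, where
  -- n m is itself a constant.
  obtain ⟨m, ⟨hm1, hm2⟩, hmin⟩ : ∃ m, (m0 ≤ m ∧ 2 * (N : ℝ) ≤ ρ * n m) ∧
      ∀ l < m, ¬ (m0 ≤ l ∧ 2 * (N : ℝ) ≤ ρ * n l) :=
    ⟨Nat.find hex, Nat.find_spec hex, fun l hl => Nat.find_min hex hl⟩
  refine ⟨m, n m, by omega, rfl, hm2, ?_, ?_⟩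
  · rcases hm1.eq_or_lt with h | h
    · rw [← h]
      calc n m0 = n m0 * 1 := (mul_one _).symm
        _ ≤ (c' + n m0) * N := Nat.mul_le_mul (by omega) hN
    · obtain ⟨l, rfl⟩ : ∃ l, m = l + 1 := ⟨m - 1, by omega⟩
      have h1 := hmin l (by omega)
      have h2 : ρ * n l < 2 * N := by
        by_contra! h3
        exact h1 ⟨by omega, h3⟩
      have h3 : (n l : ℝ) ≤ 2 / ρ * N := by
        rw [div_mul_eq_mul_div, le_div_iff₀ hρ]
        linarith
      have h4 : (n (l + 1) : ℝ) ≤ 2 ^ (1 + a + a * a) * n l := by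
        exact_mod_cast hgrow l (by omega)
      have h5 : (n (l + 1) : ℝ) ≤ c' * N := by
        calc (n (l + 1) : ℝ) ≤ 2 ^ (1 + a + a * a) * (2 / ρ * N) := h4.trans (by gcongr)
          _ = 2 ^ (1 + a + a * a) * (2 / ρ) * N := by ring
          _ ≤ c' * N := by gcongr
      have h6 : n (l + 1) ≤ c' * N := by exact_mod_cast h5
      exact h6.trans (Nat.mul_le_mul_right _ (by omega))
  · rcases le_or_gt 1 ε with h | h
    · calc (N : ℝ) ^ (1 - ε) ≤ (N : ℝ) ^ (0 : ℝ) :=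
            Real.rpow_le_rpow_of_exponent_le hN1 (by linarith)
        _ = 1 := Real.rpow_zero _
        _ ≤ _ := by exact_mod_cast Nat.one_le_two_pow
    · have h1 : n m ≤ 2 ^ (m * (a * a + a + 1)) := by
        calc n m = 2 * a * 3 ^ a * m * (2 ^ (a * m) * (2 ^ (a * m)) ^ a) := by
              simp only [n]
              rw [mul_pow]
              ring
          _ ≤ 2 ^ m * (2 ^ (a * m) * (2 ^ (a * m)) ^ a) := Nat.mul_le_mul_right _ (hm0 m hm1)
          _ = _ := by
              rw [← pow_mul, ← pow_add, ← pow_add]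
              congr 1
              ring
      have h2 : (N : ℝ) ≤ 2 ^ ((m : ℝ) * (a * a + a + 1)) := by
        have h3 : (N : ℝ) ≤ n m := by
          have : (0 : ℝ) ≤ n m := Nat.cast_nonneg _
          nlinarith
        refine h3.trans ?_
        have h4 : (n m : ℝ) ≤ 2 ^ (m * (a * a + a + 1)) := by exact_mod_cast h1
        refine h4.trans (le_of_eq ?_)
        rw [← Real.rpow_natCast]
        push_cast
        rfl
      calc (N : ℝ) ^ (1 - ε) ≤ (2 ^ ((m : ℝ) * (a * a + a + 1))) ^ (1 - ε) :=
            Real.rpow_le_rpow (by linarith) h2 (by linarith)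
        _ = 2 ^ ((m : ℝ) * (a * a + a + 1) * (1 - ε)) := by
            rw [← Real.rpow_mul (by norm_num)]
        _ ≤ 2 ^ ((((a - 1) * m * a : ℕ)) : ℝ) := by
            refine Real.rpow_le_rpow_of_exponent_le (by norm_num) ?_
            rw [ha, Nat.add_sub_cancel, ← ha]
            push_cast
            have ha'' : (a' : ℝ) = a - 1 := by rw [ha]; push_cast; ring
            rw [ha'', mul_assoc, mul_comm ((a : ℝ) - 1), mul_assoc]
            refine mul_le_mul_of_nonneg_left ?_ (Nat.cast_nonneg m)
            have ha1 : (1 : ℝ) ≤ a := by rw [ha]; push_cast; linarith [Nat.cast_nonneg (α := ℝ) a']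
            -- This is 2a + 1 ≤ ε(a² + a + 1), a consequence of 3 ≤ εa and 1 ≤ a.
            nlinarith
        _ = _ := by rw [Real.rpow_natCast]; push_cast; rfl

/-! ### Depth, and passage from ranked DAGs to digraphs. -/

theorem Digraph.HasDepthAtLeast.of_adj {V : Type*} {G : Digraph V} {S : Finset V} {t : ℝ} {u v : V}
    (h : G.HasDepthAtLeast S t u) (huv : G.Adj u v) (hv : v ∉ S) :
    G.HasDepthAtLeast S (t + 1) v := by
  obtain ⟨p, hp, hpS, hpt⟩ := h
  have hrel : (p.last, v) ∈ {e : V × V | G.Adj e.1 e.2} := by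
    rw [hp]
    exact huv
  refine ⟨p.snoc v hrel, RelSeries.last_snoc _ _ _, fun i => ?_, ?_⟩
  · have hmem : (p.snoc v hrel) i ∈ p.snoc v hrel := ⟨i, rfl⟩
    rcases RelSeries.mem_snoc.1 hmem with ⟨j, hj⟩ | h
    · rw [← hj]
      exact hpS j
    · rw [h]
      exact hv
  · have : (p.snoc v hrel).length = p.length + 1 := rfl
    rw [this]
    push_cast
    linarith

theorem Digraph.HasDepthAtLeast.mono {V : Type*} {G : Digraph V} {S : Finset V} {t t' : ℝ} {v : V}
    (h : G.HasDepthAtLeast S t v) (ht : t' ≤ t) : G.HasDepthAtLeast S t' v := by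
  obtain ⟨p, hp, hpS, hpt⟩ := h
  exact ⟨p, hp, hpS, ht.trans hpt⟩

theorem Digraph.HasDepthAtLeast.notMem {V : Type*} {G : Digraph V} {S : Finset V} {t : ℝ} {v : V}
    (h : G.HasDepthAtLeast S t v) : v ∉ S := by
  obtain ⟨p, rfl, hpS, -⟩ := h
  exact hpS _

theorem Digraph.hasDepthAtLeast_zero {V : Type*} {G : Digraph V} {S : Finset V} {v : V}
    (hv : v ∉ S) : G.HasDepthAtLeast S 0 v :=
  ⟨RelSeries.singleton _ v, rfl, fun _ => hv, by simp⟩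

/-- The underlying digraph. -/
def RankedDag.toDigraph {V : Type} (G : RankedDag V) : Digraph V where
  Adj u v := u ∈ G.par v

theorem RankedDag.isAcyclic_toDigraph {V : Type} (G : RankedDag V) : G.toDigraph.IsAcyclic := by
  have h : ∀ u v, Relation.TransGen G.toDigraph.Adj u v → G.rank u < G.rank v := by
    intro u v huv
    induction huv with
    | single h => exact G.rank_lt _ _ h
    | tail _ h ih => exact ih.trans (G.rank_lt _ _ h)
  exact fun v hv => lt_irrefl _ (h v v hv)

theorem RankedDag.indegree_toDigraph {V : Type} (G : RankedDag V) (v : V) :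
    G.toDigraph.indegree v = #(G.par v) :=
  Set.ncard_coe_finset (G.par v)

/-- Outside any deleted set there is a function that increases along the edges and is bounded by
the depth. -/
theorem RankedDag.exists_depth_function {V : Type} (G : RankedDag V) (S : Finset V) :
    ∃ f : V → ℕ, (∀ v, v ∉ S → G.toDigraph.HasDepthAtLeast S (f v) v) ∧
      ∀ v, v ∉ S → ∀ u ∈ G.par v, u ∉ S → f u < f v := by
  classical
  let P : V → ℕ → Prop := fun v m => G.toDigraph.HasDepthAtLeast S m v
  have hP : ∀ v, v ∉ S → P v (Nat.findGreatest (P v) (G.rank v)) := fun v hv =>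
    Nat.findGreatest_spec (m := 0) (Nat.zero_le _) (by
      simpa [P] using Digraph.hasDepthAtLeast_zero (G := G.toDigraph) hv)
  -- Capping the search at the rank is harmless: the rank grows along each edge, so there is always
  -- room for one more step.
  refine ⟨fun v => Nat.findGreatest (P v) (G.rank v), hP, fun v hv u hu huS => ?_⟩
  have h1 : P v (Nat.findGreatest (P u) (G.rank u) + 1) := by
    have := (hP u huS).of_adj (show G.toDigraph.Adj u v from hu) hv
    simpa [P] using this
  have h2 := Nat.findGreatest_le (P := P u) (G.rank u)
  have h3 := G.rank_lt v u hu
  have h4 : Nat.findGreatest (P u) (G.rank u) + 1 ≤ G.rank v := by omega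
  exact Nat.lt_of_succ_le (Nat.le_findGreatest h4 h1)

/-! ### Assembling the hard graph. -/

open scoped Classical in
/-- Feed the inputs of `H` from the vertices of `G`. -/
noncomputable def RankedDag.feed {V Y : Type} [Fintype V] {m d : ℕ} (G : RankedDag V)
    (H : RankedDag (Fin m ⊕ Y)) (nbr : Fin m → Fin d → V) : RankedDag (V ⊕ (Fin m ⊕ Y)) where
  par
    | .inl v => (G.par v).image .inl
    | .inr (.inl x) => univ.image fun j => .inl (nbr x j)
    | .inr (.inr y) => (H.par (.inr y)).image .inr
  rank
    | .inl v => G.rank v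
    | .inr w => univ.sup G.rank + 1 + H.rank w
  rank_lt := by
    rintro (v | v | v) u hu
    · simp only [mem_image] at hu
      obtain ⟨w, hw, rfl⟩ := hu
      exact G.rank_lt _ _ hw
    · simp only [mem_image, mem_univ, true_and] at hu
      obtain ⟨j, rfl⟩ := hu
      have := le_sup (f := G.rank) (mem_univ (nbr v j))
      simp only
      omega
    · simp only [mem_image] at hu
      obtain ⟨w, hw, rfl⟩ := hu
      have := H.rank_lt _ _ hw
      simp only
      omega

-- The vertices of depth at least `τ` form a set closed under surviving edges. It contains a
-- fraction ρ/2 of `G`, hence by the disperser at least half of the inputs of `H`; the connector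
-- property then bounds the outputs that it misses.
open scoped Classical in
theorem RankedDag.isHard_feed {V Y : Type} [Fintype V] [Fintype Y] {N d : ℕ} (G : RankedDag V)
    (H : RankedDag (Fin (16 * N) ⊕ Y)) (nbr : Fin (16 * N) → Fin d → V)
    (out : Fin N → Fin (16 * N) ⊕ Y) (hout : Function.Injective out) {ρ : ℝ} {t : ℕ}
    (hG : G.IsRobust ρ t) (hH : H.IsConnector out) (hin : ∀ x, H.par (Sum.inl x) = ∅)
    (hnbr : ∀ (X : Finset V) (W : Finset (Fin (16 * N))), ρ / 2 * Fintype.card V ≤ #X →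
      N ≤ #W → ∃ b ∈ W, ∃ j, nbr b j ∈ X)
    (hN : 2 * (N : ℝ) ≤ ρ * Fintype.card V) (hN1 : 1 ≤ N) {τ : ℝ} (hτ : τ ≤ t) {s : ℕ}
    (hs : s ≤ N) :
    (G.feed H nbr).toDigraph.IsHard (univ.image fun c => Sum.inr (out c)) s τ (s / N) := by
  intro S hS
  set F := G.feed H nbr with hF
  have hSN : (#S : ℝ) ≤ N := by exact_mod_cast hS.trans hs
  obtain ⟨f, hf1, hf2⟩ := F.exists_depth_function S
  let Z : Set (V ⊕ (Fin (16 * N) ⊕ Y)) := {w | F.toDigraph.HasDepthAtLeast S τ w}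
  have hZ : ∀ v, v ∉ S → ∀ u ∈ F.par v, u ∈ Z → v ∈ Z := fun v hv u hu huZ =>
    (Digraph.HasDepthAtLeast.of_adj huZ (show F.toDigraph.Adj u v from hu) hv).mono (by linarith)
  let SD : Finset V := {v | Sum.inl v ∈ S}
  let SH : Finset (Fin (16 * N) ⊕ Y) := {w | Sum.inr w ∈ S}
  let SI : Finset (Fin (16 * N)) := {x | Sum.inr (Sum.inl x) ∈ S}
  have hSD : ∀ v, v ∈ SD ↔ Sum.inl v ∈ S := fun v => by simp [SD]
  have hSH : ∀ v, v ∈ SH ↔ Sum.inr v ∈ S := fun v => by simp [SH]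
  have hSI : ∀ v, v ∈ SI ↔ Sum.inr (Sum.inl v) ∈ S := fun v => by simp [SI]
  have hcard : #SD + #SH ≤ #S :=
    card_add_card_le_of_inl_of_inr (fun v hv => (hSD v).1 hv) fun v hv => (hSH v).1 hv
  have hcardI : #SI ≤ #SH := by
    have := card_add_card_le_of_inl_of_inr (S := SH) (s := SI) (t := ∅)
      (fun x hx => (hSH _).2 ((hSI x).1 hx)) (by simp)
    omega
  let X : Finset V := {v | Sum.inl v ∈ Z}
  have hX : ρ / 2 * Fintype.card V ≤ #X := by
    -- Otherwise `X` could be deleted together with `SD`, at most ρ|V| vertices in all, and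
    -- robustness would yield a further vertex of depth at least t.
    by_contra! hcon
    obtain ⟨v, hv, hvt⟩ := hG (SD ∪ X) (by
      have h1 : (#(SD ∪ X) : ℝ) ≤ #SD + #X := by exact_mod_cast card_union_le _ _
      have h2 : (#SD : ℝ) ≤ #S := by exact_mod_cast (Nat.le_add_right _ _).trans hcard
      linarith) (fun v => f (Sum.inl v)) (by
      intro v hv u hu huS
      rw [mem_union, not_or] at hv huS
      refine hf2 _ (fun h => hv.1 ((hSD v).2 h)) _ ?_ (fun h => huS.1 ((hSD u).2 h))
      simp only [hF, RankedDag.feed, mem_image]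
      exact ⟨u, hu, rfl⟩)
    rw [mem_union, not_or] at hv
    refine hv.2 (mem_filter.2 ⟨mem_univ _, ?_⟩)
    refine (hf1 _ (fun h => hv.1 ((hSD v).2 h))).mono (hτ.trans ?_)
    exact_mod_cast hvt
  let X' : Finset (Fin (16 * N)) := {x | Sum.inr (Sum.inl x) ∈ Z}
  have hX' : 8 * N ≤ #X' := by
    have hlt : #(X'ᶜ \ SI) < N := by
      by_contra! hcon
      obtain ⟨b, hb, j, hj⟩ := hnbr X _ hX hcon
      obtain ⟨hb1, hb2⟩ := mem_sdiff.1 hb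
      refine (mem_compl.1 hb1) (mem_filter.2 ⟨mem_univ _,
        hZ _ (fun h => hb2 ((hSI b).2 h)) (Sum.inl (nbr b j)) ?_ (mem_filter.1 hj).2⟩)
      simp only [hF, RankedDag.feed, mem_image]
      exact ⟨j, mem_univ _, rfl⟩
    have h1 := le_card_sdiff SI X'ᶜ
    rw [card_compl, Fintype.card_fin] at h1
    omega
  have hinj : Function.Injective fun c => (Sum.inr (out c) : V ⊕ (Fin (16 * N) ⊕ Y)) :=
    Sum.inr_injective.comp hout
  have hbad := hH SH {w | Sum.inr w ∈ Z} (by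
      rintro (x | y) hv u hu huZ
      · rw [hin] at hu
        simp at hu
      · refine hZ _ (fun h => hv ((hSH _).2 h)) _ ?_ huZ
        simp only [hF, RankedDag.feed, mem_image]
        exact ⟨u, hu, rfl⟩)
    X' hX' (fun x hx => (mem_filter.1 hx).2) {c | Sum.inr (out c) ∉ Z} (fun c hc =>
      (mem_filter.1 hc).2)
  have hgood : #{c | Sum.inr (out c) ∈ Z} + #{c | Sum.inr (out c) ∉ Z} = N := by
    rw [card_filter_add_card_filter_not, card_univ, Fintype.card_fin]
  have himage : #{c | Sum.inr (out c) ∈ Z} ≤ #((univ.image fun c =>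
      (Sum.inr (out c) : V ⊕ (Fin (16 * N) ⊕ Y))).filter
        fun v => F.toDigraph.HasDepthAtLeast S τ v) := by
    rw [← card_image_of_injective _ hinj]
    refine card_le_card fun w hw => ?_
    obtain ⟨c, hc, rfl⟩ := mem_image.1 hw
    exact mem_filter.2 ⟨mem_image_of_mem _ (mem_univ c), (mem_filter.1 hc).2⟩
  have hfinal : N ≤ #((univ.image fun c => (Sum.inr (out c) : V ⊕ (Fin (16 * N) ⊕ Y))).filter
      fun v => F.toDigraph.HasDepthAtLeast S τ v) + s := by omega
  have hN0 : (0 : ℝ) < N := by exact_mod_cast hN1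
  rw [card_image_of_injective _ hinj, card_univ, Fintype.card_fin, sub_mul, one_mul,
    div_mul_cancel₀ _ hN0.ne', sub_le_iff_le_add]
  exact_mod_cast hfinal

theorem exists_hard_dag {ε : ℝ} (hε : 0 < ε) :
    ∃ K δ : ℕ, ∀ N : ℕ, 1 ≤ N →
      ∃ (V : Type) (_ : Fintype V) (G : Digraph V) (C : Finset V),
        G.IsAcyclic ∧ (∀ v : V, G.indegree v ≤ δ) ∧ Fintype.card V ≤ K * N ∧ C.card = N ∧
        ∀ s : ℕ, s ≤ N → G.IsHard C s ((N : ℝ) ^ (1 - ε)) ((s : ℝ) / (N : ℝ)) := by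
  classical
  obtain ⟨a, ha, hsize⟩ := exists_size_parameters hε
  obtain ⟨δG, ρ, hρ, hρ1, hG⟩ := exists_robust ha a
  obtain ⟨c, hc⟩ := hsize ρ hρ hρ1
  obtain ⟨δH, hH⟩ := exists_connector
  have hθ : 0 < min (ρ / 2) (1 / 16) := by positivity
  obtain ⟨d, hd⟩ := exists_disperser hθ ((min_le_right _ _).trans (by norm_num)) c
  -- The robust DAG has at most cN vertices, and the connector at most 16N + 18N.
  refine ⟨c + 34, δG + δH + d, fun N hN => ?_⟩
  obtain ⟨m, n, hm, hn, hNn, hnc, hdepth⟩ := hc N hN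
  obtain ⟨V, _, G, hVcard, hGδ, hGrob⟩ := hG m hm
  rw [← hn] at hVcard
  obtain ⟨Y, _, H, out, hout, hYcard, hin, hHδ, hHconn⟩ := hH N
  have hVpos : 0 < Fintype.card V := by
    rw [hVcard]
    rcases Nat.eq_zero_or_pos n with h | h
    · exfalso
      rw [h] at hNn
      have : (1 : ℝ) ≤ N := by exact_mod_cast hN
      simp at hNn
      linarith
    · exact h
  have : Nonempty V := Fintype.card_pos_iff.1 hVpos
  obtain ⟨nbr, hnbr⟩ := hd V (Fin (16 * N)) (by
    rw [hVcard, Fintype.card_fin]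
    exact hnc.trans (Nat.mul_le_mul_left _ (by omega)))
  refine ⟨_, inferInstance, (G.feed H nbr).toDigraph, univ.image fun c => Sum.inr (out c),
    RankedDag.isAcyclic_toDigraph _, fun v => ?_, ?_, ?_, fun s hs => ?_⟩
  · rw [RankedDag.indegree_toDigraph]
    obtain v | v | v := v
    · simp only [RankedDag.feed]
      have := hGδ v
      exact card_image_le.trans (by omega)
    · simp only [RankedDag.feed]
      refine card_image_le.trans ?_
      rw [card_univ, Fintype.card_fin]
      omega
    · simp only [RankedDag.feed]
      have := hHδ (Sum.inr v)
      exact card_image_le.trans (by omega)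
  · rw [Fintype.card_sum, Fintype.card_sum, hVcard, Fintype.card_fin, add_mul]
    omega
  · have hinj : Function.Injective fun c => (Sum.inr (out c) : V ⊕ (Fin (16 * N) ⊕ Y)) :=
      Sum.inr_injective.comp hout
    rw [card_image_of_injective _ hinj, card_univ, Fintype.card_fin]
  · have h := RankedDag.isHard_feed G H nbr out hout hGrob hHconn hin (fun X W hX hW => ?_)
      (by rw [hVcard]; exact hNn) hN hdepth hs
    · convert h
    · refine hnbr X W (le_trans ?_ hX) ?_
      · exact mul_le_mul_of_nonneg_right (min_le_left _ _) (Nat.cast_nonneg _)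
      · rw [Fintype.card_fin]
        have h1 : (N : ℝ) ≤ #W := by exact_mod_cast hW
        have h2 := min_le_right (ρ / 2) (1 / 16)
        push_cast
        have h3 : (0 : ℝ) ≤ N := Nat.cast_nonneg _
        nlinarith

/-! ### Optimality of the last parameter. -/

/-- Delete s vertices of `C` itself: a deleted vertex has no depth, whatever `t` is. -/
theorem Digraph.IsHard.div_card_le {V : Type*} {G : Digraph V} {C : Finset V} (hC : 1 ≤ #C) {s : ℕ}
    (hs : s ≤ #C) {t α : ℝ} (h : G.IsHard C s t α) : (s : ℝ) / #C ≤ α := by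
  classical
  obtain ⟨S, hSC, hScard⟩ := exists_subset_card_eq hs
  have h1 := h S hScard.le
  have h2 : #(C.filter fun v => G.HasDepthAtLeast S t v) ≤ #(C \ S) :=
    card_le_card fun v hv => mem_sdiff.2 ⟨(mem_filter.1 hv).1, (mem_filter.1 hv).2.notMem⟩
  have h3 : #(C \ S) + s = #C := by
    rw [card_sdiff_of_subset hSC, hScard]
    omega
  have h4 : (1 - α) * #C + s ≤ #C := by
    have h5 : (#(C.filter fun v => G.HasDepthAtLeast S t v) : ℝ) + s ≤ #C := by
      exact_mod_cast (show #(C.filter fun v => G.HasDepthAtLeast S t v) + s ≤ #C by omega)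
    refine le_trans (add_le_add_left ?_ _) h5
    convert h1
  have hC' : (0 : ℝ) < #C := by exact_mod_cast hC
  rw [div_le_iff₀ hC']
  linarith

theorem mainTheorem11 :
    (∀ ε : ℝ, 0 < ε → ∃ K δ : ℕ, ∀ N : ℕ, 1 ≤ N →
      ∃ (V : Type) (_ : Fintype V) (G : Digraph V) (C : Finset V),
        G.IsAcyclic ∧ (∀ v : V, G.indegree v ≤ δ) ∧ Fintype.card V ≤ K * N ∧ C.card = N ∧
        ∀ s : ℕ, s ≤ N → G.IsHard C s ((N : ℝ) ^ (1 - ε)) ((s : ℝ) / (N : ℝ))) ∧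
    (∀ (V : Type) (_ : Fintype V) (G : Digraph V) (C : Finset V), G.IsAcyclic → 1 ≤ C.card →
      ∀ s : ℕ, s ≤ C.card → ∀ t α : ℝ, G.IsHard C s t α → (s : ℝ) / (C.card : ℝ) ≤ α) :=
  ⟨fun _ hε => exists_hard_dag hε, fun _ _ _ _ _ hC _ hs _ _ h => h.div_card_le hC hs⟩
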